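/- Let $k\ge 1$ be an integer and $a\in\mathbb R$. Consider in $\mathbb R^2\setminus\{0\}$ the system $$\dot u=-v+u\big((u^2+v^2)^{-k}+a\big),\qquad \dot v=u+v\big((u^2+v^2)^{-k}+a\big)$$ (the geometric inversion of the Hopf system $\dot x=-y-x((x^2+y^2)^k+a)$, $\dot y=x-y((x^2+y^2)^k+a)$), or the polynomial system with the same phase portrait outside the origin, $$\dot u=-v(u^2+v^2)^k+u\big(1+a(u^2+v^2)^k\big),\qquad \dot v=u(u^2+v^2)^k+v\big(1+a(u^2+v^2)^k\big).$$ By a trajectory we mean the image of a solution on an interval of positive (possibly infinite) length; a set is away from the origin if its distance from the origin is positive. For a bounded set $A\subset\mathbb R^n$ let $\mathcal M^{*s}(A)$ and $\mathcal M_*^s(A)$ be the upper and lower limits of $|A_\varepsilon|/\varepsilon^{n-s}$ as $\varepsilon\to0^+$, where $A_\varepsilon$ is the $\varepsilon$-neighbourhood of $A$; the upper and lower box dimensions are $\overline{\dim}_BA=\inf\{s>0:\mathcal M^{*s}(A)=0\}$ and $\underline{\dim}_BA=\inf\{s>0:\mathcal M_*^{s}(A)=0\}$, with common value $\dim_BA$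 if they are equal; $A$ is Minkowski measurable if $0<\mathcal M_*^d(A)=\mathcal M^{*d}(A)<\infty$ for some $d\ge0$. For an unbounded set $A$ away from the origin all these notions are defined as the corresponding ones of $\Phi(A)$, where $\Phi(x)=x/|x|^2$. **Theorem 3.4 (Hopf bifurcation at infinity).** If $a=0$, then every unbounded (spiral) trajectory $\Gamma$ away from the origin, of either system, satisfies $$\dim_B\Gamma=\frac{4k}{2k+1},$$ and $\Gamma$ is Minkowski measurable. If $a\ne0$, then every trajectory $\Gamma$ away from the origin, bounded or unbounded, of either system satisfies $\dim_B\Gamma=1$. -/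

import Mathlib

open Filter Topology MeasureTheory

noncomputable section

namespace HopfInfinity

/-- The Euclidean space of dimension `n` with its Euclidean norm. -/
abbrev Space (n : ℕ) : Type := EuclideanSpace ℝ (Fin n)

/-! ### Minkowski contents and box dimension of bounded sets -/

/-- The quotient `|A_ε| / ε ^ (n - s)`, where `A_ε` is the open `ε`-neighbourhood of `A`. -/
def minkowskiQuotient {n : ℕ} (s : ℝ) (A : Set (Space n)) (ε : ℝ) : ENNReal :=
  volume (Metric.thickening ε A) / ENNReal.ofReal (ε ^ ((n : ℝ) - s))

/-- Upper `s`-dimensional Minkowski content of a bounded set. -/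
def bddUpperContent {n : ℕ} (s : ℝ) (A : Set (Space n)) : ENNReal :=
  limsup (minkowskiQuotient s A) (𝓝[>] (0 : ℝ))

/-- Lower `s`-dimensional Minkowski content of a bounded set. -/
def bddLowerContent {n : ℕ} (s : ℝ) (A : Set (Space n)) : ENNReal :=
  liminf (minkowskiQuotient s A) (𝓝[>] (0 : ℝ))

/-! ### Extension to unbounded sets by geometric inversion -/

/-- The geometric inversion `x ↦ x / |x|²` with respect to the origin. -/
def invert {n : ℕ} (x : Space n) : Space n := EuclideanGeometry.inversion 0 1 x

/-- The set on which contents and dimensions of `A` are computed: `A` itself if it is bounded,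
and its image under the geometric inversion if it is unbounded. (For unbounded `A` this is used
only when `A` has positive distance from the origin, so that the image is bounded.) -/
def boundedModel {n : ℕ} (A : Set (Space n)) : Set (Space n) :=
  open Classical in if Bornology.IsBounded A then A else invert '' A

/-- Upper `s`-dimensional Minkowski content (bounded or unbounded sets). -/
def upperContent {n : ℕ} (s : ℝ) (A : Set (Space n)) : ENNReal :=
  bddUpperContent s (boundedModel A)

/-- Lower `s`-dimensional Minkowski content (bounded or unbounded sets). -/
def lowerContent {n : ℕ} (s : ℝ) (A : Set (Space n)) : ENNReal :=
  bddLowerContent s (boundedModel A)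

/-- Upper box dimension. The set whose infimum is taken contains every `s > n`. -/
def upperBoxDim {n : ℕ} (A : Set (Space n)) : ℝ :=
  sInf {s : ℝ | 0 < s ∧ upperContent s A = 0}

/-- Lower box dimension. The set whose infimum is taken contains every `s > n`. -/
def lowerBoxDim {n : ℕ} (A : Set (Space n)) : ℝ :=
  sInf {s : ℝ | 0 < s ∧ lowerContent s A = 0}

/-- The box dimension of `A` exists and equals `d`. -/
def HasBoxDim {n : ℕ} (A : Set (Space n)) (d : ℝ) : Prop :=
  upperBoxDim A = d ∧ lowerBoxDim A = d

/-- `A` is Minkowski measurable: for some `d ≥ 0` its lower and upper `d`-dimensional contents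
agree and the common value lies in `(0, ∞)`. -/
def IsMinkowskiMeasurable {n : ℕ} (A : Set (Space n)) : Prop :=
  ∃ d : ℝ, 0 ≤ d ∧ lowerContent d A = upperContent d A ∧
    0 < upperContent d A ∧ upperContent d A < ⊤

/-- `A` has positive distance from the origin. -/
def AwayFromOrigin {n : ℕ} (A : Set (Space n)) : Prop :=
  ∃ δ : ℝ, 0 < δ ∧ ∀ x ∈ A, δ ≤ ‖x‖

/-! ### The planar systems -/

/-- The system
`u' = -v + u ((u² + v²)⁻ᵏ + a)`, `v' = u + v ((u² + v²)⁻ᵏ + a)` on the punctured plane. -/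
def hopfField (k : ℕ) (a : ℝ) (p : Space 2) : Space 2 :=
  !₂[-p 1 + p 0 * (((p 0 ^ 2 + p 1 ^ 2) ^ k)⁻¹ + a),
     p 0 + p 1 * (((p 0 ^ 2 + p 1 ^ 2) ^ k)⁻¹ + a)]

/-- The polynomial system
`u' = -v (u² + v²)ᵏ + u (1 + a (u² + v²)ᵏ)`, `v' = u (u² + v²)ᵏ + v (1 + a (u² + v²)ᵏ)`. -/
def hopfPolyField (k : ℕ) (a : ℝ) (p : Space 2) : Space 2 :=
  !₂[-p 1 * (p 0 ^ 2 + p 1 ^ 2) ^ k + p 0 * (1 + a * (p 0 ^ 2 + p 1 ^ 2) ^ k),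
     p 0 * (p 0 ^ 2 + p 1 ^ 2) ^ k + p 1 * (1 + a * (p 0 ^ 2 + p 1 ^ 2) ^ k)]

/-- `Γ` is (a portion of) a trajectory of the vector field `X`: the set of values of a solution
on an interval `J` of positive, possibly infinite, length. Semitrajectories and maximal
trajectories are included. -/
def IsTrajectory (X : Space 2 → Space 2) (Γ : Set (Space 2)) : Prop :=
  ∃ (γ : ℝ → Space 2) (J : Set ℝ), J.OrdConnected ∧ J.Nontrivial ∧
    IsIntegralCurveOn γ (fun _ => X) J ∧ Γ = γ '' J

end HopfInfinity

end

namespace HopfInfinity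

/-! ### Contents and box dimensions from growth rates of neighbourhoods -/

/-! Identify the plane with `ℂ`. Both fields become `z' = μ (i + |z|^(-2k) + a) z` with `μ > 0` (`μ
= 1` or `μ = |z|^(2k)`), so the argument `φ` increases strictly along a solution and `w = |z|^(2k)`
satisfies `dw/dφ = 2k (1 + a w)`. Hence a trajectory away from the origin is a polar graph `r =
W(φ)^(1/2k)` over an interval of angles, with `W` affine if `a = 0` and `W = (C e^(2kaφ) - 1)/a`
otherwise (`exists_polar_form`). Inversion keeps the angle and changes the sign of the exponent.

Case `a = 0`, unbounded: put `m = 2k`. The inverted curve is `r = (mφ + c)^(-1/m)`, for which `dr/dφ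
= -r^(m+1)`, so coils at radius `R` are about `2π R^(m+1)` apart. Let `ε = π R^(m+1)`. Outside
radius about `R` the `ε`-tube does not overlap itself and has area about `2ε ∫ r dφ ≈ 2π R²/(m-1)`;
inside, the neighbourhood fills a disk of area about `π R²`. The total is asymptotic to a constant
times `ε^(2/(m+1))` (`tendsto_volume_powerSpiral`), which gives the dimension `2 - 2/(m+1) =
4k/(2k+1)` and a content in `(0, ∞)`.

Case `a ≠ 0`: the bounded model either covers a bounded range of angles or tends exponentially to a
circle or to the origin at its infinite ends. About `log(1/ε)` turns suffice to come within a
multiple of `ε` of the limit, so the area is `O(ε (1 - log ε))` (`volume_thickening_expSpiral_le`).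
Connectedness gives a lower bound `c ε` (`le_volume_thickening_polarCurve`), and the logarithm does
not affect the dimension (`hasBoxDim_one_of_bounds`). -/

lemma minkowskiQuotient_eq_mul {n : ℕ} (d s : ℝ) (A : Set (Space n)) {ε : ℝ} (hε : 0 < ε) :
    minkowskiQuotient s A ε = minkowskiQuotient d A ε * ENNReal.ofReal (ε ^ (s - d)) := by
  unfold minkowskiQuotient
  have h1 : ε ^ ((n : ℝ) - d) = ε ^ ((n : ℝ) - s) * ε ^ (s - d) := by
    rw [← Real.rpow_add hε]; congr 1; ring
  have h2 : 0 < ε ^ (s - d) := Real.rpow_pos_of_pos hε _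
  have h3 : 0 < ε ^ ((n : ℝ) - s) := Real.rpow_pos_of_pos hε _
  rw [h1, ENNReal.ofReal_mul h3.le, ENNReal.div_eq_inv_mul, ENNReal.div_eq_inv_mul,
    ENNReal.mul_inv (Or.inr ENNReal.ofReal_ne_top) (Or.inl ENNReal.ofReal_ne_top)]
  have h4 : ENNReal.ofReal (ε ^ (s - d)) ≠ 0 := by simpa using h2
  rw [mul_assoc, mul_assoc, mul_comm (volume _), ← mul_assoc _ _ (volume _),
    ENNReal.inv_mul_cancel h4 ENNReal.ofReal_ne_top, one_mul]

lemma tendsto_rpow_zero_of_pos {p : ℝ} (hp : 0 < p) :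
    Tendsto (fun ε : ℝ => ENNReal.ofReal (ε ^ p)) (𝓝[>] 0) (𝓝 0) := by
  have h : Tendsto (fun ε : ℝ => ε ^ p) (𝓝 0) (𝓝 (0 ^ p)) :=
    (Real.continuousAt_rpow_const 0 p (Or.inr hp.le)).tendsto
  rw [Real.zero_rpow hp.ne'] at h
  simpa using ENNReal.tendsto_ofReal (h.mono_left nhdsWithin_le_nhds)

lemma tendsto_rpow_top_of_neg {p : ℝ} (hp : p < 0) :
    Tendsto (fun ε : ℝ => ENNReal.ofReal (ε ^ p)) (𝓝[>] 0) (𝓝 ⊤) :=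
  ENNReal.tendsto_ofReal_atTop.comp (tendsto_rpow_neg_nhdsGT_zero hp)

/-- Both dimensions are infima of the exponents with vanishing content. The hypotheses place this
threshold at `d` without any information on the content at `d` itself. -/
lemma hasBoxDim_of_tendsto {n : ℕ} {A : Set (Space n)} {d : ℝ} (hd : 0 < d)
    (hU : ∀ s, d < s → Tendsto (minkowskiQuotient s (boundedModel A)) (𝓝[>] 0) (𝓝 0))
    (hL : ∀ s, s < d → Tendsto (minkowskiQuotient s (boundedModel A)) (𝓝[>] 0) (𝓝 ⊤)) :
    HasBoxDim A d := by
  have key : ∀ f : ℝ → ENNReal, (∀ s, d < s → f s = 0) → (∀ s, s < d → f s = ⊤) →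
      sInf {s : ℝ | 0 < s ∧ f s = 0} = d := by
    intro f h0 h1
    refine csInf_eq_of_forall_ge_of_forall_gt_exists_lt ⟨d + 1, by linarith, h0 _ (by linarith)⟩ ?_ ?_
    · rintro s ⟨-, hs⟩
      by_contra! hlt
      simp [h1 s hlt] at hs
    · intro w hw
      exact ⟨(d + w) / 2, ⟨by linarith, h0 _ (by linarith)⟩, by linarith⟩
  exact ⟨key _ (fun s hs => (hU s hs).limsup_eq) (fun s hs => (hL s hs).limsup_eq),
    key _ (fun s hs => (hU s hs).liminf_eq) (fun s hs => (hL s hs).liminf_eq)⟩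

lemma hasBoxDim_and_measurable_of_tendsto {n : ℕ} {A : Set (Space n)} {d : ℝ} (hd : 0 < d)
    {M : ENNReal} (hM0 : M ≠ 0) (hM : M ≠ ⊤)
    (h : Tendsto (minkowskiQuotient d (boundedModel A)) (𝓝[>] 0) (𝓝 M)) :
    HasBoxDim A d ∧ IsMinkowskiMeasurable A := by
  have heq : ∀ s, minkowskiQuotient s (boundedModel A) =ᶠ[𝓝[>] 0]
      fun ε => minkowskiQuotient d (boundedModel A) ε * ENNReal.ofReal (ε ^ (s - d)) := by
    intro s
    filter_upwards [self_mem_nhdsWithin] with ε hε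
    exact minkowskiQuotient_eq_mul d s _ hε
  refine ⟨hasBoxDim_of_tendsto hd (fun s hs => ?_) (fun s hs => ?_), d, hd.le, ?_⟩
  · refine Tendsto.congr' (heq s).symm ?_
    simpa using ENNReal.Tendsto.mul h (Or.inr ENNReal.zero_ne_top)
      (tendsto_rpow_zero_of_pos (sub_pos.2 hs)) (Or.inr hM)
  · refine Tendsto.congr' (heq s).symm ?_
    have := ENNReal.Tendsto.mul h (Or.inl hM0)
      (tendsto_rpow_top_of_neg (sub_neg.2 hs)) (Or.inr hM)
    rwa [ENNReal.mul_top hM0] at this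
  · have h1 : lowerContent d A = M := h.liminf_eq
    have h2 : upperContent d A = M := h.limsup_eq
    rw [h1, h2]
    exact ⟨rfl, pos_iff_ne_zero.2 hM0, hM.lt_top⟩

/-- After division by `ε^(2 - s)` the upper bound is `ε^(s - 1) (1 - log ε)`, and every positive
power of `ε` beats the logarithm. -/
lemma hasBoxDim_one_of_bounds {A : Set (Space 2)} {c C : ℝ} (hc : 0 < c)
    (hL : ∀ᶠ ε in 𝓝[>] (0 : ℝ),
      ENNReal.ofReal (c * ε) ≤ volume (Metric.thickening ε (boundedModel A)))
    (hU : ∀ᶠ ε in 𝓝[>] (0 : ℝ),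
      volume (Metric.thickening ε (boundedModel A)) ≤ ENNReal.ofReal (C * (ε * (1 - Real.log ε)))) :
    HasBoxDim A 1 := by
  have hε2 : ∀ {ε : ℝ} (s : ℝ), 0 < ε → ε / ε ^ (((2 : ℕ) : ℝ) - s) = ε ^ (s - 1) := by
    intro ε s hε
    rw [div_eq_iff (Real.rpow_pos_of_pos hε _).ne', ← Real.rpow_add hε]
    conv_lhs => rw [← Real.rpow_one ε]
    congr 1
    push_cast
    ring
  refine hasBoxDim_of_tendsto one_pos (fun s hs => ?_) (fun s hs => ?_)
  · have h1 : Tendsto (fun ε : ℝ => C * (ε ^ (s - 1) * (1 - Real.log ε))) (𝓝[>] 0) (𝓝 0) := by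
      have h2 : Tendsto (fun ε : ℝ => ε ^ (s - 1)) (𝓝[>] 0) (𝓝 0) := by
        have h : Tendsto (fun ε : ℝ => ε ^ (s - 1)) (𝓝 0) (𝓝 (0 ^ (s - 1))) :=
          (Real.continuousAt_rpow_const 0 _ (Or.inr (sub_pos.2 hs).le)).tendsto
        rw [Real.zero_rpow (sub_pos.2 hs).ne'] at h
        exact h.mono_left nhdsWithin_le_nhds
      have h3 := tendsto_log_mul_rpow_nhdsGT_zero (sub_pos.2 hs)
      have h4 := (h2.sub h3).const_mul C
      simp only [sub_zero, mul_zero] at h4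
      refine h4.congr fun ε => ?_
      ring
    have h5 := ENNReal.tendsto_ofReal h1
    rw [ENNReal.ofReal_zero] at h5
    refine tendsto_of_tendsto_of_tendsto_of_le_of_le' tendsto_const_nhds h5
      (Eventually.of_forall fun _ => zero_le) ?_
    filter_upwards [hU, self_mem_nhdsWithin] with ε h hε
    have hε : 0 < ε := hε
    unfold minkowskiQuotient
    refine (ENNReal.div_le_div_right h _).trans ?_
    rw [← ENNReal.ofReal_div_of_pos (Real.rpow_pos_of_pos hε _)]
    refine ENNReal.ofReal_le_ofReal (le_of_eq ?_)
    rw [← hε2 s hε]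
    ring
  · have h1 : Tendsto (fun ε : ℝ => ENNReal.ofReal c * ENNReal.ofReal (ε ^ (s - 1)))
        (𝓝[>] 0) (𝓝 ⊤) := by
      have := ENNReal.Tendsto.mul (tendsto_const_nhds (x := ENNReal.ofReal c))
        (Or.inl (by simpa using hc)) (tendsto_rpow_top_of_neg (sub_neg.2 hs))
        (Or.inr ENNReal.ofReal_ne_top)
      rwa [ENNReal.mul_top (by simpa using hc)] at this
    refine tendsto_of_tendsto_of_tendsto_of_le_of_le' h1 tendsto_const_nhds ?_
      (Eventually.of_forall fun _ => le_top)
    filter_upwards [hL, self_mem_nhdsWithin] with ε h hε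
    have hε : 0 < ε := hε
    unfold minkowskiQuotient
    refine le_trans ?_ (ENNReal.div_le_div_right h _)
    rw [← ENNReal.ofReal_div_of_pos (Real.rpow_pos_of_pos hε _), ← ENNReal.ofReal_mul hc.le]
    refine ENNReal.ofReal_le_ofReal (le_of_eq ?_)
    rw [← hε2 s hε]
    ring

/-! ### Areas of neighbourhoods of planar sets -/

lemma volume_ball_complex (z : ℂ) {r : ℝ} (hr : 0 ≤ r) :
    volume (Metric.ball z r) = ENNReal.ofReal (Real.pi * r ^ 2) := by
  rw [Complex.volume_ball, ENNReal.ofReal_mul Real.pi_pos.le, ENNReal.ofReal_pow hr, mul_comm]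
  congr 1
  rw [← NNReal.coe_real_pi, ENNReal.ofReal_coe_nnreal]

/-- Area of the neighbourhood of a Lipschitz image of a bounded set of parameters. -/
lemma volume_thickening_image_le {f : ℝ → ℂ} {S : Set ℝ} {a b K : ℝ} (hab : a ≤ b) (hK : 0 ≤ K)
    (hS : S ⊆ Set.Icc a b) (hf : ∀ x ∈ S, ∀ y ∈ S, ‖f x - f y‖ ≤ K * |x - y|)
    {ε : ℝ} (hε : 0 < ε) :
    volume (Metric.thickening ε (f '' S)) ≤
      ENNReal.ofReal (((b - a) + 2 * ε) * (Real.pi * (K + 2) ^ 2) * ε) := by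
  classical
  -- Parameters are sorted into cells of length `ε`; the extra cell accounts for the right end
  -- point. The image of a cell has diameter at most `K ε`, so its `ε`-neighbourhood fits in a
  -- single ball.
  set N : ℕ := ⌊(b - a) / ε⌋₊ + 1 with hN
  have hq : 0 ≤ (b - a) / ε := div_nonneg (by linarith) hε.le
  have hex : ∀ i : ℕ, ∃ p : ℂ, Metric.thickening ε
      (f '' {x ∈ S | ⌊(x - a) / ε⌋₊ = i}) ⊆ Metric.ball p ((K + 2) * ε) := by
    intro i
    by_cases hne : ∃ x ∈ S, ⌊(x - a) / ε⌋₊ = i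
    · obtain ⟨x, hx, hxi⟩ := hne
      refine ⟨f x, ?_⟩
      intro w hw
      rw [Metric.mem_thickening_iff] at hw
      obtain ⟨_, ⟨y, ⟨hy, hyi⟩, rfl⟩, hwy⟩ := hw
      have hx0 : 0 ≤ (x - a) / ε := div_nonneg (by linarith [(hS hx).1]) hε.le
      have hy0 : 0 ≤ (y - a) / ε := div_nonneg (by linarith [(hS hy).1]) hε.le
      have h1 := Nat.floor_le hx0
      have h2 := Nat.lt_floor_add_one ((x - a) / ε)
      have h3 := Nat.floor_le hy0
      have h4 := Nat.lt_floor_add_one ((y - a) / ε)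
      rw [hxi] at h1 h2
      rw [hyi] at h3 h4
      rw [le_div_iff₀ hε] at h1 h3
      rw [div_lt_iff₀ hε] at h2 h4
      have h5 : |y - x| ≤ ε := by
        rw [abs_le]; constructor <;> nlinarith
      have h6 := hf y hy x hx
      rw [Metric.mem_ball]
      calc dist w (f x) ≤ dist w (f y) + dist (f y) (f x) := dist_triangle _ _ _
        _ < ε + K * ε := by
          rw [dist_eq_norm (f y)]
          have := mul_le_mul_of_nonneg_left h5 hK
          linarith
        _ ≤ (K + 2) * ε := by nlinarith
    · refine ⟨0, ?_⟩
      have : {x ∈ S | ⌊(x - a) / ε⌋₊ = i} = ∅ := by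
        ext x; simp only [Set.mem_ofPred_eq, Set.mem_empty_iff_false, iff_false]
        exact fun h => hne ⟨x, h⟩
      simp [this]
  choose p hp using hex
  have hcov : Metric.thickening ε (f '' S) ⊆
      ⋃ i ∈ Finset.range N, Metric.ball (p i) ((K + 2) * ε) := by
    intro w hw
    rw [Metric.mem_thickening_iff] at hw
    obtain ⟨_, ⟨x, hx, rfl⟩, hwx⟩ := hw
    refine Set.mem_biUnion (x := ⌊(x - a) / ε⌋₊) ?_ (hp _ ?_)
    · simp only [Finset.coe_range, Set.mem_Iio, hN]
      refine Nat.lt_succ_of_le (Nat.floor_le_floor ?_)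
      gcongr
      exact (hS hx).2
    · exact Metric.mem_thickening_iff.2 ⟨f x, ⟨x, ⟨hx, rfl⟩, rfl⟩, hwx⟩
  have hKε : 0 ≤ (K + 2) * ε := by positivity
  calc volume (Metric.thickening ε (f '' S))
      ≤ volume (⋃ i ∈ Finset.range N, Metric.ball (p i) ((K + 2) * ε)) := measure_mono hcov
    _ ≤ ∑ i ∈ Finset.range N, volume (Metric.ball (p i) ((K + 2) * ε)) :=
        measure_biUnion_finset_le _ _
    _ = ENNReal.ofReal (N * (Real.pi * ((K + 2) * ε) ^ 2)) := by
        simp only [volume_ball_complex _ hKε, Finset.sum_const, Finset.card_range, nsmul_eq_mul]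
        rw [ENNReal.ofReal_mul (Nat.cast_nonneg _), ENNReal.ofReal_natCast]
    _ ≤ _ := by
        refine ENNReal.ofReal_le_ofReal ?_
        have h1 := Nat.floor_le hq
        have h2 : (N : ℝ) * ε ≤ (b - a) + ε := by
          rw [hN]; push_cast
          rw [le_div_iff₀ hε] at h1
          linarith
        calc (N : ℝ) * (Real.pi * ((K + 2) * ε) ^ 2)
            = (N * ε) * (Real.pi * (K + 2) ^ 2 * ε) := by ring
          _ ≤ ((b - a) + 2 * ε) * (Real.pi * (K + 2) ^ 2 * ε) := by
              gcongr; linarith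
          _ = _ := by ring

/-- A connected set with two points has neighbourhoods of at least linear area. -/
lemma le_volume_thickening_of_isPreconnected {A : Set ℂ} (hA : IsPreconnected A) {z₀ z₁ : ℂ}
    (h₀ : z₀ ∈ A) (h₁ : z₁ ∈ A) {ε : ℝ} (hε : 0 < ε) :
    ENNReal.ofReal (dist z₁ z₀ * ε) ≤ volume (Metric.thickening ε A) := by
  set l := dist z₁ z₀ with hl
  set N : ℕ := ⌊l / (2 * ε)⌋₊ with hN
  have hl0 : 0 ≤ l / (2 * ε) := by positivity
  -- The distance to `z₀` takes every value in `[0, l]` on `A`. Points at distances that are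
  -- distinct multiples of `2ε` carry disjoint `ε`-balls.
  have hex : ∀ i ∈ Finset.range (N + 1), ∃ p ∈ A, dist p z₀ = i * (2 * ε) := by
    intro i hi
    have hiN : (i : ℝ) ≤ N := by exact_mod_cast Nat.lt_succ_iff.1 (Finset.mem_range.1 hi)
    have h1 : (i : ℝ) * (2 * ε) ≤ l := by
      rw [← le_div_iff₀ (by positivity)]
      exact hiN.trans (Nat.floor_le hl0)
    have := hA.intermediate_value h₀ h₁ (f := fun p => dist p z₀) (by fun_prop)
    exact this ⟨by simp only [dist_self]; positivity, h1⟩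
  choose! p hpA hp using hex
  have hdisj : Set.PairwiseDisjoint (↑(Finset.range (N + 1))) fun i => Metric.ball (p i) ε := by
    intro i hi j hj hij
    refine Metric.ball_disjoint_ball ?_
    have h1 : |dist (p i) z₀ - dist (p j) z₀| ≤ dist (p i) (p j) := abs_dist_sub_le _ _ _
    rw [hp i hi, hp j hj, ← sub_mul, abs_mul, abs_of_pos (by positivity : 0 < 2 * ε)] at h1
    have h2 : (1 : ℝ) ≤ |(i : ℝ) - j| := by
      have : (1 : ℤ) ≤ |(i : ℤ) - j| := Int.one_le_abs (sub_ne_zero.2 (by exact_mod_cast hij))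
      exact_mod_cast this
    nlinarith
  calc ENNReal.ofReal (l * ε)
      ≤ ENNReal.ofReal ((N + 1 : ℕ) * (Real.pi * ε ^ 2)) := by
        refine ENNReal.ofReal_le_ofReal ?_
        have h1 := Nat.lt_floor_add_one (l / (2 * ε))
        rw [div_lt_iff₀ (by positivity)] at h1
        have h2 := Real.pi_gt_three
        push_cast
        rw [← hN] at h1
        have h3 : (0 : ℝ) ≤ (N + 1) * ε * ε := by positivity
        nlinarith
    _ = ∑ i ∈ Finset.range (N + 1), volume (Metric.ball (p i) ε) := by
        simp only [volume_ball_complex _ hε.le, Finset.sum_const, Finset.card_range, nsmul_eq_mul]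
        rw [ENNReal.ofReal_mul (Nat.cast_nonneg _), ENNReal.ofReal_natCast]
    _ = volume (⋃ i ∈ Finset.range (N + 1), Metric.ball (p i) ε) :=
        (measure_biUnion_finset hdisj fun _ _ => measurableSet_ball).symm
    _ ≤ _ := by
        refine measure_mono (Set.iUnion₂_subset fun i hi => ?_)
        exact Metric.ball_subset_thickening (hpA i hi) ε

/-! ### Neighbourhoods of polar curves converging exponentially to a circle or a point -/

/-- The curve with polar equation `r = ρ φ`. -/
noncomputable def polarCurve (ρ : ℝ → ℝ) (φ : ℝ) : ℂ := (ρ φ : ℂ) * Complex.exp (φ * Complex.I)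

lemma norm_polarCurve (ρ : ℝ → ℝ) (φ : ℝ) : ‖polarCurve ρ φ‖ = |ρ φ| := by
  rw [polarCurve, norm_mul, Complex.norm_exp_ofReal_mul_I, mul_one, Complex.norm_real,
    Real.norm_eq_abs]

lemma norm_exp_sub_exp_le (x y : ℝ) :
    ‖Complex.exp (x * Complex.I) - Complex.exp (y * Complex.I)‖ ≤ |x - y| := by
  have h : Complex.exp (x * Complex.I) - Complex.exp (y * Complex.I) =
      Complex.exp (y * Complex.I) * (Complex.exp (Complex.I * ((x - y : ℝ) : ℂ)) - 1) := by
    rw [mul_sub, ← Complex.exp_add, mul_one]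
    congr 2
    push_cast
    ring
  rw [h, norm_mul, Complex.norm_exp_ofReal_mul_I, one_mul, ← Real.norm_eq_abs]
  exact Real.norm_exp_I_mul_ofReal_sub_one_le

lemma norm_polarCurve_sub_le (ρ σ : ℝ → ℝ) (x y : ℝ) :
    ‖polarCurve ρ x - polarCurve σ y‖ ≤ |ρ x - σ y| + |σ y| * |x - y| := by
  have h : polarCurve ρ x - polarCurve σ y = ((ρ x - σ y : ℝ) : ℂ) * Complex.exp (x * Complex.I) +
      (σ y : ℂ) * (Complex.exp (x * Complex.I) - Complex.exp (y * Complex.I)) := by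
    simp only [polarCurve]; push_cast; ring
  rw [h]
  refine (norm_add_le _ _).trans ?_
  rw [norm_mul, norm_mul, Complex.norm_exp_ofReal_mul_I, mul_one, Complex.norm_real,
    Complex.norm_real, Real.norm_eq_abs, Real.norm_eq_abs]
  gcongr
  exact norm_exp_sub_exp_le x y

lemma exp_neg_sub_exp_neg_le {c x y : ℝ} (hc : 0 ≤ c) (hx : 0 ≤ x) (hxy : x ≤ y) :
    Real.exp (-(c * x)) - Real.exp (-(c * y)) ≤ c * (y - x) := by
  have h1 : Real.exp (-(c * y)) = Real.exp (-(c * x)) * Real.exp (-(c * (y - x))) := by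
    rw [← Real.exp_add]; congr 1; ring
  have h2 := Real.add_one_le_exp (-(c * (y - x)))
  have h3 : Real.exp (-(c * x)) ≤ 1 := Real.exp_le_one_iff.2 (by nlinarith)
  have h4 := Real.exp_pos (-(c * x))
  have h5 : 0 ≤ c * (y - x) := mul_nonneg hc (by linarith)
  rw [h1]
  nlinarith

/-- The angles are cut at `T`, where `e^(-cT) = ε`. Up to `T` the curve is Lipschitz over an
interval of length `-log ε / c`; beyond `T` it stays within `K ε` of a single circle, whose
neighbourhood has area `O(ε)`. The difference of exponentials in `hρ` yields both the Lipschitz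
constant and the closeness. -/
lemma volume_thickening_spiral_le {ρ : ℝ → ℝ} {S : Set ℝ} {c K M : ℝ} (hc : 0 < c) (hK : 0 ≤ K)
    (hM : 0 ≤ M) (hS : S ⊆ Set.Ici 0) (hρM : ∀ x ∈ S, |ρ x| ≤ M)
    (hρ : ∀ x ∈ S, ∀ y ∈ S, x ≤ y →
      |ρ x - ρ y| ≤ K * (Real.exp (-(c * x)) - Real.exp (-(c * y)))) :
    ∃ C : ℝ, ∀ᶠ ε in 𝓝[>] (0 : ℝ), volume (Metric.thickening ε (polarCurve ρ '' S)) ≤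
      ENNReal.ofReal (C * (ε * (1 - Real.log ε))) := by
  refine ⟨(1 / c + 2) * (Real.pi * (K * c + M + 2) ^ 2) +
    (2 * Real.pi + 2 * (K + 1)) * (Real.pi * (M + 2) ^ 2) * (K + 1), ?_⟩
  filter_upwards [Ioo_mem_nhdsGT (zero_lt_one' ℝ)] with ε hε
  obtain ⟨hε0, hε1⟩ := hε
  have hlog : Real.log ε ≤ 0 := Real.log_nonpos hε0.le hε1.le
  set T : ℝ := -Real.log ε / c with hT
  have hT0 : 0 ≤ T := div_nonneg (by linarith) hc.le
  have hTε : Real.exp (-(c * T)) = ε := by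
    rw [hT, mul_div_cancel₀ _ hc.ne', neg_neg, Real.exp_log hε0]
  have hLip : ∀ x ∈ S, ∀ y ∈ S, ‖polarCurve ρ x - polarCurve ρ y‖ ≤ (K * c + M) * |x - y| := by
    intro x hx y hy
    have h1 : |ρ x - ρ y| ≤ K * c * |x - y| := by
      rcases le_total x y with h | h
      · rw [abs_of_nonpos (by linarith : x - y ≤ 0)]
        have := mul_le_mul_of_nonneg_left (exp_neg_sub_exp_neg_le hc.le (hS hx) h) hK
        have := hρ x hx y hy h
        linarith
      · rw [abs_of_nonneg (by linarith : 0 ≤ x - y), abs_sub_comm]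
        have := mul_le_mul_of_nonneg_left (exp_neg_sub_exp_neg_le hc.le (hS hy) h) hK
        have := hρ y hy x hx h
        linarith
    have h2 := norm_polarCurve_sub_le ρ ρ x y
    have h3 := mul_le_mul_of_nonneg_right (hρM y hy) (abs_nonneg (x - y))
    linarith
  have hsplit : S = (S ∩ Set.Iic T) ∪ (S ∩ Set.Ioi T) := by
    rw [← Set.inter_union_distrib_left, Set.Iic_union_Ioi, Set.inter_univ]
  have hfst : volume (Metric.thickening ε (polarCurve ρ '' (S ∩ Set.Iic T))) ≤
      ENNReal.ofReal (((T - 0) + 2 * ε) * (Real.pi * (K * c + M + 2) ^ 2) * ε) :=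
    volume_thickening_image_le hT0 (by positivity) (fun x hx => ⟨hS hx.1, hx.2⟩)
      (fun x hx y hy => hLip x hx.1 y hy.1) hε0
  have hsnd : volume (Metric.thickening ε (polarCurve ρ '' (S ∩ Set.Ioi T))) ≤
      ENNReal.ofReal (((2 * Real.pi - 0) + 2 * ((K + 1) * ε)) * (Real.pi * (M + 2) ^ 2) *
        ((K + 1) * ε)) := by
    -- Any angle `ψ` beyond `T` supplies the comparison circle, of radius `ρ ψ`; no limit radius is
    -- needed, and radius `0` is not excluded.
    rcases (S ∩ Set.Ioi T).eq_empty_or_nonempty with he | ⟨ψ, hψS, hψT⟩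
    · simp [he]
    refine le_trans (measure_mono ?_) (volume_thickening_image_le
      (f := polarCurve fun _ => ρ ψ) (S := Set.Icc 0 (2 * Real.pi)) (by positivity) hM
      subset_rfl ?_ (by positivity))
    · intro w hw
      rw [Metric.mem_thickening_iff] at hw ⊢
      obtain ⟨_, ⟨x, ⟨hxS, hxT⟩, rfl⟩, hwx⟩ := hw
      have hTx : T < x := hxT
      have hTψ : T < ψ := hψT
      have h1 : |ρ x - ρ ψ| ≤ K * ε := by
        have hx1 : Real.exp (-(c * x)) ≤ ε := by
          rw [← hTε]; exact Real.exp_le_exp.2 (by nlinarith)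
        have hψ1 : Real.exp (-(c * ψ)) ≤ ε := by
          rw [← hTε]; exact Real.exp_le_exp.2 (by nlinarith)
        have hx0 := Real.exp_pos (-(c * x))
        have hψ0 := Real.exp_pos (-(c * ψ))
        rcases le_total x ψ with h | h
        · exact (hρ x hxS ψ hψS h).trans (mul_le_mul_of_nonneg_left (by linarith) hK)
        · rw [abs_sub_comm]
          exact (hρ ψ hψS x hxS h).trans (mul_le_mul_of_nonneg_left (by linarith) hK)
      obtain ⟨y, hy, hy2⟩ : ∃ y ∈ Set.Icc 0 (2 * Real.pi),
          Complex.exp (y * Complex.I) = Complex.exp (x * Complex.I) := by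
        have hper : Function.Periodic (fun t : ℝ => Complex.exp (t * Complex.I)) (2 * Real.pi) := by
          intro t
          simp only
          push_cast
          rw [add_mul, Complex.exp_add, Complex.exp_two_pi_mul_I, mul_one]
        obtain ⟨y, hy, h⟩ := hper.exists_mem_Ico₀ Real.two_pi_pos x
        exact ⟨y, Set.Ico_subset_Icc_self hy, h.symm⟩
      refine ⟨_, ⟨y, hy, rfl⟩, ?_⟩
      have h2 : polarCurve (fun _ => ρ ψ) y = polarCurve (fun _ => ρ ψ) x := by
        simp only [polarCurve, hy2]
      rw [h2]
      have h3 := norm_polarCurve_sub_le ρ (fun _ => ρ ψ) x x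
      simp only [sub_self, abs_zero, mul_zero, add_zero] at h3
      rw [← dist_eq_norm] at h3
      calc dist w _ ≤ dist w (polarCurve ρ x) + dist (polarCurve ρ x) _ := dist_triangle _ _ _
        _ < ε + K * ε := by linarith
        _ = (K + 1) * ε := by ring
    · intro x _ y _
      have h2 := norm_polarCurve_sub_le (fun _ => ρ ψ) (fun _ => ρ ψ) x y
      have h3 := mul_le_mul_of_nonneg_right (hρM ψ hψS) (abs_nonneg (x - y))
      simp only [sub_self, abs_zero, zero_add] at h2
      linarith
  calc volume (Metric.thickening ε (polarCurve ρ '' S))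
      ≤ volume (Metric.thickening ε (polarCurve ρ '' (S ∩ Set.Iic T))) +
        volume (Metric.thickening ε (polarCurve ρ '' (S ∩ Set.Ioi T))) := by
        conv_lhs => rw [hsplit, Set.image_union, Metric.thickening_union]
        exact measure_union_le _ _
    _ ≤ _ := add_le_add hfst hsnd
    _ = _ := (ENNReal.ofReal_add (by rw [sub_zero]; positivity) (by rw [sub_zero]; positivity)).symm
    _ ≤ _ := by
        refine ENNReal.ofReal_le_ofReal ?_
        have h1 : (T - 0) + 2 * ε ≤ (1 / c + 2) * (1 - Real.log ε) := by
          have : T = 1 / c * (-Real.log ε) := by rw [hT]; ring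
          rw [this]
          have hc' : 0 < 1 / c := by positivity
          nlinarith
        have h2 : (2 * Real.pi - 0) + 2 * ((K + 1) * ε) ≤
            (2 * Real.pi + 2 * (K + 1)) * (1 - Real.log ε) := by
          have := Real.pi_pos
          have h3 : (K + 1) * ε ≤ K + 1 := by nlinarith
          nlinarith
        calc ((T - 0) + 2 * ε) * (Real.pi * (K * c + M + 2) ^ 2) * ε +
              ((2 * Real.pi - 0) + 2 * ((K + 1) * ε)) * (Real.pi * (M + 2) ^ 2) * ((K + 1) * ε)
            ≤ ((1 / c + 2) * (1 - Real.log ε)) * (Real.pi * (K * c + M + 2) ^ 2) * ε +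
              ((2 * Real.pi + 2 * (K + 1)) * (1 - Real.log ε)) * (Real.pi * (M + 2) ^ 2) *
                ((K + 1) * ε) := by gcongr
          _ = _ := by ring

/-! ### Solutions in polar coordinates -/

/-- This supplies the angle function. `J` may contain some of its end points and `μ` is controlled
only on `J`, hence derivatives within `J`. -/
lemma exists_hasDerivWithinAt_of_continuousOn {J : Set ℝ} (hJ : J.OrdConnected) {μ : ℝ → ℝ}
    (hμ : ContinuousOn μ J) : ∃ θ : ℝ → ℝ, ∀ t ∈ J, HasDerivWithinAt θ (μ t) J t := by
  rcases J.eq_empty_or_nonempty with rfl | ⟨t₀, ht₀⟩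
  · exact ⟨0, fun t ht => ht.elim⟩
  have hint : ∀ s ∈ J, ∀ t ∈ J, IntervalIntegrable μ volume s t := fun s hs t ht =>
    (hμ.mono (hJ.uIcc_subset hs ht)).intervalIntegrable
  refine ⟨fun t => ∫ s in t₀..t, μ s, fun t ht => ?_⟩
  rw [hasDerivWithinAt_iff_isLittleO, Asymptotics.isLittleO_iff]
  intro c hc
  obtain ⟨δ, hδ, hball⟩ := Metric.continuousWithinAt_iff.1 (hμ t ht) c hc
  filter_upwards [self_mem_nhdsWithin, mem_nhdsWithin_of_mem_nhds (Metric.ball_mem_nhds t hδ)]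
    with u hu hut
  have h1 : (∫ s in t₀..u, μ s) - (∫ s in t₀..t, μ s) - (u - t) • μ t =
      ∫ s in t..u, (μ s - μ t) := by
    rw [intervalIntegral.integral_interval_sub_left (hint _ ht₀ _ hu) (hint _ ht₀ _ ht),
      intervalIntegral.integral_sub (hint _ ht _ hu) intervalIntegrable_const,
      intervalIntegral.integral_const]
  rw [h1]
  refine intervalIntegral.norm_integral_le_of_norm_le_const fun s hs => ?_
  have hs' : s ∈ Set.uIcc t u := Set.uIoc_subset_uIcc hs
  have h2 : dist s t < δ := by
    rw [dist_comm]
    rw [Metric.mem_ball, dist_comm] at hut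
    exact (Real.dist_left_le_of_mem_uIcc hs').trans_lt hut
  have := hball (hJ.uIcc_subset ht hu hs') h2
  rw [dist_eq_norm] at this
  exact this.le

lemma eq_of_hasDerivWithinAt_zero {E : Type*} [NormedAddCommGroup E] [NormedSpace ℝ E]
    {f : ℝ → E} {J : Set ℝ} (hJ : J.OrdConnected) (hf : ∀ t ∈ J, HasDerivWithinAt f 0 J t)
    {s t : ℝ} (hs : s ∈ J) (ht : t ∈ J) : f t = f s := by
  have := hJ.convex.norm_image_sub_le_of_norm_hasDerivWithin_le (C := 0) hf (by simp) hs ht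
  rwa [zero_mul, norm_le_zero_iff, sub_eq_zero] at this

lemma strictMonoOn_of_hasDerivWithinAt_pos {θ μ : ℝ → ℝ} {J : Set ℝ} (hJ : J.OrdConnected)
    (hθ : ∀ t ∈ J, HasDerivWithinAt θ (μ t) J t) (hμ : ∀ t ∈ J, 0 < μ t) : StrictMonoOn θ J := by
  refine strictMonoOn_of_deriv_pos hJ.convex (fun t ht => (hθ t ht).continuousWithinAt) ?_
  intro t ht
  rw [((hθ t (interior_subset ht)).hasDerivAt (mem_interior_iff_mem_nhds.1 ht)).deriv]
  exact hμ t (interior_subset ht)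

/-- The rotational part `μ i z` is orthogonal to `z`, so only `μ g z` changes the modulus. -/
lemma hasDerivWithinAt_norm_of_mul {z : ℝ → ℂ} {J : Set ℝ} {t μ g : ℝ} (hz0 : z t ≠ 0)
    (hz : HasDerivWithinAt z ((μ : ℂ) * (Complex.I + (g : ℂ)) * z t) J t) :
    HasDerivWithinAt (fun s => ‖z s‖) (μ * g * ‖z t‖) J t := by
  have h1 := hz.norm_sq
  have hn : 0 < ‖z t‖ := norm_pos_iff.2 hz0
  have h2 := h1.sqrt (by positivity)
  simp only [Real.sqrt_sq (norm_nonneg _)] at h2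
  convert h2 using 1
  have h3 : inner ℝ (z t) ((μ : ℂ) * (Complex.I + (g : ℂ)) * z t) = μ * g * ‖z t‖ ^ 2 := by
    rw [Complex.inner, ← Complex.normSq_eq_norm_sq, Complex.normSq_apply]
    simp
    ring
  rw [h3]
  field_simp

/-- Solutions of `z' = μ (i + |z|⁻²ᵏ + a) z` run on curves `|z|²ᵏ = W (arg z)` with `W` explicit. -/
lemma exists_polar_form {k : ℕ} (hk : 1 ≤ k) {a δ : ℝ} (hδ : 0 < δ) {J : Set ℝ}
    (hJ : J.OrdConnected) (hJn : J.Nontrivial) {z : ℝ → ℂ} {μ : ℝ → ℝ}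
    (hμ : ∀ t ∈ J, 0 < μ t) (hμc : ContinuousOn μ J) (hzδ : ∀ t ∈ J, δ ≤ ‖z t‖)
    (hz : ∀ t ∈ J, HasDerivWithinAt z
      ((μ t : ℂ) * (Complex.I + (((‖z t‖ ^ (2 * k))⁻¹ + a : ℝ) : ℂ)) * z t) J t) :
    ∃ (S : Set ℝ) (W : ℝ → ℝ), S.OrdConnected ∧ S.Nontrivial ∧
      (∀ φ ∈ S, δ ^ (2 * k) ≤ W φ) ∧
      z '' J = polarCurve (fun φ => W φ ^ ((2 * k : ℝ)⁻¹)) '' S ∧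
      (a = 0 → ∃ c, ∀ φ, W φ = 2 * k * φ + c) ∧
      (a ≠ 0 → ∃ C, ∀ φ, W φ = (C * Real.exp (2 * k * a * φ) - 1) / a) := by
  have hz0 : ∀ t ∈ J, z t ≠ 0 := fun t ht h => by
    have := hzδ t ht
    rw [h, norm_zero] at this
    linarith
  have hnpos : ∀ t ∈ J, 0 < ‖z t‖ := fun t ht => norm_pos_iff.2 (hz0 t ht)
  obtain ⟨θ₀, hθ₀⟩ := exists_hasDerivWithinAt_of_continuousOn hJ hμc
  obtain ⟨t₀, ht₀⟩ := hJn.nonempty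
  have hn : ∀ t ∈ J, HasDerivWithinAt (fun s => ‖z s‖)
      (μ t * ((‖z t‖ ^ (2 * k))⁻¹ + a) * ‖z t‖) J t := fun t ht =>
    hasDerivWithinAt_norm_of_mul (hz0 t ht) (hz t ht)
  set θ : ℝ → ℝ := fun t => θ₀ t - θ₀ t₀ + Complex.arg (z t₀) with hθdef
  have hθ : ∀ t ∈ J, HasDerivWithinAt θ (μ t) J t := fun t ht =>
    ((hθ₀ t ht).sub_const _).add_const _
  -- The quotient `z e^(-iθ) / |z|` has zero derivative and equals `1` at `t₀` by the normalisation
  -- of `θ`.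
  have hpolar : ∀ t ∈ J, z t = (‖z t‖ : ℂ) * Complex.exp (θ t * Complex.I) := by
    intro t ht
    have hq : ∀ s ∈ J, HasDerivWithinAt
        (fun s => z s * Complex.exp (-(θ s * Complex.I)) / (‖z s‖ : ℂ)) 0 J s := by
      intro s hs
      have h1 : HasDerivWithinAt (fun s => (θ s : ℂ)) (μ s) J s := (hθ s hs).ofReal_comp
      have h2 : HasDerivWithinAt (fun s => Complex.exp (-(θ s * Complex.I)))
          (Complex.exp (-(θ s * Complex.I)) * -(μ s * Complex.I)) J s :=
        (h1.mul_const Complex.I).neg.cexp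
      have h3 : HasDerivWithinAt (fun s => (‖z s‖ : ℂ)) _ J s := (hn s hs).ofReal_comp
      have hne : (‖z s‖ : ℂ) ≠ 0 := by exact_mod_cast (hnpos s hs).ne'
      have h4 : HasDerivWithinAt (fun s => z s * Complex.exp (-(θ s * Complex.I))) _ J s :=
        (hz s hs).mul h2
      refine (h4.div h3 hne).congr_deriv ?_
      rw [div_eq_zero_iff]
      left
      push_cast
      ring
    have h := eq_of_hasDerivWithinAt_zero hJ hq ht₀ ht
    have harg : θ t₀ = Complex.arg (z t₀) := by simp [hθdef]
    have hne₀ : (‖z t₀‖ : ℂ) ≠ 0 := by exact_mod_cast (hnpos t₀ ht₀).ne'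
    have hne : (‖z t‖ : ℂ) ≠ 0 := by exact_mod_cast (hnpos t ht).ne'
    have h1 : z t₀ * Complex.exp (-(θ t₀ * Complex.I)) / (‖z t₀‖ : ℂ) = 1 := by
      rw [div_eq_one_iff_eq hne₀, harg]
      conv_lhs => rw [← Complex.norm_mul_exp_arg_mul_I (z t₀)]
      rw [mul_assoc, Complex.norm_mul_exp_arg_mul_I, ← Complex.exp_add, add_neg_cancel,
        Complex.exp_zero, mul_one]
    rw [h1, div_eq_one_iff_eq hne] at h
    rw [← h, mul_assoc, ← Complex.exp_add, neg_add_cancel, Complex.exp_zero, mul_one]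
  have hw : ∀ t ∈ J, HasDerivWithinAt (fun s => ‖z s‖ ^ (2 * k))
      (2 * k * μ t * (1 + a * ‖z t‖ ^ (2 * k))) J t := by
    intro t ht
    refine ((hn t ht).pow (2 * k)).congr_deriv ?_
    have hp := hnpos t ht
    have h1 : ‖z t‖ ^ (2 * k - 1) * ‖z t‖ = ‖z t‖ ^ (2 * k) := by
      rw [← pow_succ]; congr 1; omega
    have h2 : ‖z t‖ ^ (2 * k) ≠ 0 := by positivity
    calc _ = ((2 * k : ℕ) : ℝ) * (μ t * ((‖z t‖ ^ (2 * k))⁻¹ + a)) *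
          (‖z t‖ ^ (2 * k - 1) * ‖z t‖) := by ring
      _ = _ := by
        rw [h1]
        push_cast
        field_simp
  have hθmono := strictMonoOn_of_hasDerivWithinAt_pos hJ hθ hμ
  -- With `w = |z|^(2k)`, the first integrals are `w - 2kθ` if `a = 0` and `(1 + a w) e^(-2kaθ)` if
  -- `a ≠ 0`. Solving for `w` gives `W`.
  have hW : ∃ W : ℝ → ℝ, (∀ t ∈ J, W (θ t) = ‖z t‖ ^ (2 * k)) ∧
      (a = 0 → ∃ c, ∀ φ, W φ = 2 * k * φ + c) ∧
      (a ≠ 0 → ∃ C, ∀ φ, W φ = (C * Real.exp (2 * k * a * φ) - 1) / a) := by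
    by_cases ha : a = 0
    · subst ha
      refine ⟨fun φ => 2 * k * φ + (‖z t₀‖ ^ (2 * k) - 2 * k * θ t₀), fun t ht => ?_,
        fun _ => ⟨_, fun _ => rfl⟩, fun h => (h rfl).elim⟩
      have hd : ∀ s ∈ J, HasDerivWithinAt (fun s => ‖z s‖ ^ (2 * k) - 2 * k * θ s) 0 J s := by
        intro s hs
        refine ((hw s hs).sub ((hθ s hs).const_mul (2 * k : ℝ))).congr_deriv ?_
        ring
      have h := eq_of_hasDerivWithinAt_zero hJ hd ht₀ ht
      linarith
    · refine ⟨fun φ => ((1 + a * ‖z t₀‖ ^ (2 * k)) * Real.exp (-(2 * k * a * θ t₀)) *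
        Real.exp (2 * k * a * φ) - 1) / a, fun t ht => ?_,
        fun h => (ha h).elim, fun _ => ⟨_, fun _ => rfl⟩⟩
      have hd : ∀ s ∈ J, HasDerivWithinAt
          (fun s => (1 + a * ‖z s‖ ^ (2 * k)) * Real.exp (-(2 * k * a * θ s))) 0 J s := by
        intro s hs
        refine ((((hw s hs).const_mul a).const_add 1).mul
          (((hθ s hs).const_mul (2 * k * a : ℝ)).neg.exp)).congr_deriv ?_
        ring
      have h := eq_of_hasDerivWithinAt_zero hJ hd ht₀ ht
      beta_reduce
      rw [← h, mul_assoc (1 + _), ← Real.exp_add, neg_add_cancel, Real.exp_zero, mul_one]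
      field_simp
      ring
  obtain ⟨W, hWz, hWa, hWb⟩ := hW
  refine ⟨θ '' J, W, ?_, hJn.image_of_injOn hθmono.injOn, ?_, ?_, hWa, hWb⟩
  · exact (hJ.isPreconnected.image θ fun t ht => (hθ t ht).continuousWithinAt).ordConnected
  · rintro _ ⟨t, ht, rfl⟩
    rw [hWz t ht]
    exact pow_le_pow_left₀ hδ.le (hzδ t ht) _
  · rw [Set.image_image]
    refine Set.image_congr fun t ht => ?_
    have hk0 : 2 * k ≠ 0 := by omega
    have : (2 * k : ℝ)⁻¹ = (((2 * k : ℕ) : ℝ))⁻¹ := by push_cast; rfl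
    rw [polarCurve, hWz t ht, this, Real.pow_rpow_inv_natCast (norm_nonneg _) hk0]
    exact hpolar t ht

/-! ### Curves `r = (D e^{bφ} - q)^p` -/

lemma volume_thickening_image_linearIsometryEquiv {E F : Type*}
    [NormedAddCommGroup E] [InnerProductSpace ℝ E] [FiniteDimensional ℝ E] [MeasurableSpace E]
    [BorelSpace E] [NormedAddCommGroup F] [InnerProductSpace ℝ F] [FiniteDimensional ℝ F]
    [MeasurableSpace F] [BorelSpace F] (e : E ≃ₗᵢ[ℝ] F) (A : Set E) (ε : ℝ) :
    volume (Metric.thickening ε (e '' A)) = volume (Metric.thickening ε A) := by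
  have h : Metric.thickening ε A = e ⁻¹' Metric.thickening ε (e '' A) := by
    ext x
    simp [Metric.mem_thickening_iff]
  rw [h, e.measurePreserving.measure_preimage Metric.isOpen_thickening.nullMeasurableSet]

/-- The derivative bound integrates to a difference of exponentials with constant `K / c`. -/
lemma volume_thickening_spiral_le_of_deriv {ρ ρ' : ℝ → ℝ} {S : Set ℝ} {c K M : ℝ} (hc : 0 < c)
    (hS : S ⊆ Set.Ici 0) (hSc : S.OrdConnected) (hρM : ∀ x ∈ S, |ρ x| ≤ M)
    (hρ : ∀ x ∈ S, HasDerivAt ρ (ρ' x) x) (hρ' : ∀ x ∈ S, |ρ' x| ≤ K * Real.exp (-(c * x))) :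
    ∃ C : ℝ, ∀ᶠ ε in 𝓝[>] (0 : ℝ), volume (Metric.thickening ε (polarCurve ρ '' S)) ≤
      ENNReal.ofReal (C * (ε * (1 - Real.log ε))) := by
  rcases S.eq_empty_or_nonempty with rfl | ⟨x₀, hx₀⟩
  · exact ⟨0, by simp⟩
  have hM : 0 ≤ M := (abs_nonneg _).trans (hρM x₀ hx₀)
  have hK : 0 ≤ K := nonneg_of_mul_nonneg_left ((abs_nonneg _).trans (hρ' x₀ hx₀)) (Real.exp_pos _)
  refine volume_thickening_spiral_le hc (div_nonneg hK hc.le) hM hS hρM fun x hx y hy hxy => ?_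
  have hsub : Set.Icc x y ⊆ S := hSc.out hx hy
  have h := image_norm_le_of_norm_deriv_right_le_deriv_boundary (a := x) (b := y)
    (f := fun t => ρ t - ρ x) (f' := ρ')
    (B := fun t => K / c * (Real.exp (-(c * x)) - Real.exp (-(c * t))))
    (B' := fun t => K * Real.exp (-(c * t)))
    (fun t ht => ((hρ t (hsub ht)).sub_const _).continuousAt.continuousWithinAt)
    (fun t ht => ((hρ t (hsub (Set.Ico_subset_Icc_self ht))).sub_const _).hasDerivWithinAt)
    (by simp) (fun t => by
      have h1 : HasDerivAt (fun t : ℝ => Real.exp (-(c * t))) (Real.exp (-(c * t)) * -(c * 1)) t :=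
        ((hasDerivAt_id t).const_mul c).neg.exp
      refine ((h1.const_sub (Real.exp (-(c * x)))).const_mul (K / c)).congr_deriv ?_
      field_simp)
    (fun t ht => hρ' t (hsub (Set.Ico_subset_Icc_self ht)))
    (Set.right_mem_Icc.2 hxy)
  rw [abs_sub_comm]
  exact h

/-- As `W ≥ η` and `p ≤ 1`, the derivative of `ρ` is `O(e^(bx))`. This decays if `b < 0`. If `b > 0`
and `S` is unbounded, positivity of `W` excludes `D < 0`, the bound `M` excludes `D > 0` with `p >
0`, and what remains is a circle or decay like `e^(bpx)` with `p < 0`. -/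
lemma volume_thickening_expSpiral_half_le {W ρ : ℝ → ℝ} {S : Set ℝ} {D b q p η M : ℝ}
    (hb : b ≠ 0) (hp : p ≠ 0) (hp1 : p ≤ 1) (hη : 0 < η)
    (hWdef : ∀ x, W x = D * Real.exp (b * x) - q) (hρdef : ∀ x, ρ x = W x ^ p)
    (hS : S ⊆ Set.Ici 0) (hSc : S.OrdConnected)
    (hW : ∀ x ∈ S, η ≤ W x) (hρM : ∀ x ∈ S, ρ x ≤ M) :
    ∃ C : ℝ, ∀ᶠ ε in 𝓝[>] (0 : ℝ), volume (Metric.thickening ε (polarCurve ρ '' S)) ≤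
      ENNReal.ofReal (C * (ε * (1 - Real.log ε))) := by
  obtain rfl : W = fun x => D * Real.exp (b * x) - q := funext hWdef
  obtain rfl : ρ = fun x => (D * Real.exp (b * x) - q) ^ p := funext hρdef
  simp only at hW hρM
  have hWpos : ∀ x ∈ S, 0 < D * Real.exp (b * x) - q := fun x hx => hη.trans_le (hW x hx)
  have hder : ∀ x ∈ S, HasDerivAt (fun x => (D * Real.exp (b * x) - q) ^ p)
      (D * (Real.exp (b * x) * b) * p * (D * Real.exp (b * x) - q) ^ (p - 1)) x := by
    intro x hx
    have h1 : HasDerivAt (fun x : ℝ => Real.exp (b * x)) (Real.exp (b * x) * (b * 1)) x :=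
      ((hasDerivAt_id x).const_mul b).exp
    refine (((h1.const_mul D).sub_const q).rpow_const (Or.inl (hWpos x hx).ne')).congr_deriv ?_
    rw [mul_one]
  have habs : ∀ x ∈ S, |(D * Real.exp (b * x) - q) ^ p| ≤ M := fun x hx => by
    rw [abs_of_pos (Real.rpow_pos_of_pos (hWpos x hx) p)]
    exact hρM x hx
  have hbound : ∀ x ∈ S, |D * (Real.exp (b * x) * b) * p * (D * Real.exp (b * x) - q) ^ (p - 1)| ≤
      (|D| * |b| * |p| * η ^ (p - 1)) * Real.exp (b * x) := by
    intro x hx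
    have h1 : (D * Real.exp (b * x) - q) ^ (p - 1) ≤ η ^ (p - 1) :=
      Real.rpow_le_rpow_of_nonpos hη (hW x hx) (by linarith)
    rw [abs_mul, abs_mul, abs_mul, abs_mul, abs_of_pos (Real.exp_pos _),
      abs_of_pos (Real.rpow_pos_of_pos (hWpos x hx) (p - 1))]
    calc _ = (|D| * |b| * |p|) * (D * Real.exp (b * x) - q) ^ (p - 1) * Real.exp (b * x) := by ring
      _ ≤ (|D| * |b| * |p|) * η ^ (p - 1) * Real.exp (b * x) := by gcongr
  rcases lt_or_gt_of_ne hb with hb | hb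
  · refine volume_thickening_spiral_le_of_deriv (K := |D| * |b| * |p| * η ^ (p - 1))
      (neg_pos.2 hb) hS hSc habs hder fun x hx => ?_
    rw [neg_mul, neg_neg]
    exact hbound x hx
  by_cases hbd : ∃ T, S ⊆ Set.Iic T
  · obtain ⟨T, hT⟩ := hbd
    -- On a bounded range of angles any decay rate will do; the factor `e^T` in the constant
    -- compensates for it.
    refine volume_thickening_spiral_le_of_deriv (c := 1)
      (K := (|D| * |b| * |p| * η ^ (p - 1)) * Real.exp (b * T) * Real.exp T)
      one_pos hS hSc habs hder fun x hx => (hbound x hx).trans ?_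
    have hxT : x ≤ T := hT hx
    have h1 : 1 ≤ Real.exp T * Real.exp (-(1 * x)) := by
      rw [← Real.exp_add]
      exact Real.one_le_exp (by linarith)
    have h2 : Real.exp (b * x) ≤ Real.exp (b * T) :=
      Real.exp_le_exp.2 (mul_le_mul_of_nonneg_left hxT hb.le)
    rw [mul_assoc _ (Real.exp T)]
    have h3 : 0 ≤ |D| * |b| * |p| * η ^ (p - 1) := by positivity
    calc _ ≤ |D| * |b| * |p| * η ^ (p - 1) * Real.exp (b * T) := by gcongr
      _ ≤ _ := le_mul_of_one_le_right (by positivity) h1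
  have hfar : ∀ T, ∃ x ∈ S, T < Real.exp (b * x) := by
    intro T
    by_contra! h
    refine hbd ⟨T / b, fun x hx => ?_⟩
    have h1 := h x hx
    have h2 := Real.add_one_le_exp (b * x)
    rw [Set.mem_Iic, le_div_iff₀ hb]
    linarith
  rcases lt_trichotomy D 0 with hD | hD | hD
  · obtain ⟨x, hx, hxT⟩ := hfar (q / D)
    rw [div_lt_iff_of_neg hD] at hxT
    have := hWpos x hx
    linarith [mul_comm D (Real.exp (b * x))]
  · refine volume_thickening_spiral_le_of_deriv (c := 1) (K := 0)
      one_pos hS hSc habs hder fun x hx => ?_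
    simp [hD]
  rcases lt_or_gt_of_ne hp with hp | hp
  -- Since `W ≥ η`, also `D e^(bx) = W + q ≤ Q W`. So `W` is at least a multiple of `e^(bx)`, and
  -- the derivative is `O(W^p)`, hence `O(e^(bpx))`.
  · set Q := 1 + |q| / η with hQ
    have hQ0 : 0 < Q := by positivity
    have hDQ : 0 < D / Q := by positivity
    refine volume_thickening_spiral_le_of_deriv (c := b * -p) (K := b * -p * Q * (D / Q) ^ p)
      (by nlinarith) hS hSc habs hder fun x hx => ?_
    have hw := hWpos x hx
    set w := D * Real.exp (b * x) - q with hwdef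
    have h1 : D * Real.exp (b * x) ≤ Q * w := by
      have h2 : |q| ≤ |q| / η * w := by
        rw [div_mul_eq_mul_div, le_div_iff₀ hη]
        exact mul_le_mul_of_nonneg_left (hW x hx) (abs_nonneg _)
      have h3 := le_abs_self q
      rw [hQ]
      linarith
    have h2 : D / Q * Real.exp (b * x) ≤ w := by
      rw [div_mul_eq_mul_div, div_le_iff₀ hQ0]
      linarith
    have h3 : w ^ p ≤ (D / Q) ^ p * Real.exp (-(b * -p * x)) := by
      refine (Real.rpow_le_rpow_of_nonpos (by positivity) h2 hp.le).trans (le_of_eq ?_)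
      rw [Real.mul_rpow hDQ.le (Real.exp_pos _).le, ← Real.exp_mul]
      congr 2
      ring
    have h4 : w ^ p = w ^ (p - 1) * w := by
      rw [← Real.rpow_add_one hw.ne']; congr 1; ring
    have h5 : 0 < w ^ (p - 1) := Real.rpow_pos_of_pos hw _
    rw [abs_mul, abs_of_pos h5, abs_mul, abs_of_neg hp,
      abs_of_nonneg (by positivity : 0 ≤ D * (Real.exp (b * x) * b))]
    calc D * (Real.exp (b * x) * b) * -p * w ^ (p - 1)
        = (b * -p * w ^ (p - 1)) * (D * Real.exp (b * x)) := by ring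
      _ ≤ (b * -p * w ^ (p - 1)) * (Q * w) :=
          mul_le_mul_of_nonneg_left h1 (mul_nonneg (mul_nonneg hb.le (by linarith)) h5.le)
      _ = (b * -p * Q) * w ^ p := by rw [h4]; ring
      _ ≤ (b * -p * Q) * ((D / Q) ^ p * Real.exp (-(b * -p * x))) :=
          mul_le_mul_of_nonneg_left h3 (mul_nonneg (mul_nonneg hb.le (by linarith)) hQ0.le)
      _ = _ := by ring
  · obtain ⟨x, hx, hxT⟩ := hfar ((M ^ p⁻¹ + q) / D)
    rw [div_lt_iff₀ hD] at hxT
    have hw := hWpos x hx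
    have h1 := Real.rpow_le_rpow (Real.rpow_pos_of_pos hw p).le (hρM x hx) (inv_pos.2 hp).le
    rw [Real.rpow_rpow_inv hw.le hp.ne'] at h1
    linarith [mul_comm D (Real.exp (b * x))]

/-- Changing the sign of the angle is complex conjugation, an isometry. Negative angles thus reduce
to nonnegative ones, with `b` replaced by `-b`. -/
lemma polarCurve_image_inter_Iic (ρ : ℝ → ℝ) (S : Set ℝ) :
    polarCurve ρ '' (S ∩ Set.Iic 0) =
      Complex.conjLIE '' (polarCurve (fun x => ρ (-x)) '' ((-S) ∩ Set.Ici 0)) := by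
  have hconj : ∀ x, Complex.conjLIE (polarCurve (fun x => ρ (-x)) x) = polarCurve ρ (-x) := by
    intro x
    simp [polarCurve, ← Complex.exp_conj]
  rw [Set.image_image]
  simp only [hconj]
  ext w
  constructor
  · rintro ⟨x, ⟨hx, hx0⟩, rfl⟩
    exact ⟨-x, ⟨by simpa using hx, by simpa using hx0⟩, by simp⟩
  · rintro ⟨x, ⟨hx, hx0⟩, rfl⟩
    exact ⟨-x, ⟨hx, by simpa using hx0⟩, rfl⟩

lemma volume_thickening_expSpiral_le {W ρ : ℝ → ℝ} {S : Set ℝ} {D b q p η M : ℝ}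
    (hb : b ≠ 0) (hp : p ≠ 0) (hp1 : p ≤ 1) (hη : 0 < η)
    (hWdef : ∀ x, W x = D * Real.exp (b * x) - q) (hρdef : ∀ x, ρ x = W x ^ p)
    (hSc : S.OrdConnected) (hW : ∀ x ∈ S, η ≤ W x) (hρM : ∀ x ∈ S, ρ x ≤ M) :
    ∃ C : ℝ, ∀ᶠ ε in 𝓝[>] (0 : ℝ), volume (Metric.thickening ε (polarCurve ρ '' S)) ≤
      ENNReal.ofReal (C * (ε * (1 - Real.log ε))) := by
  obtain ⟨C₁, h₁⟩ := volume_thickening_expSpiral_half_le hb hp hp1 hη hWdef hρdef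
    (S := S ∩ Set.Ici 0) Set.inter_subset_right (hSc.inter Set.ordConnected_Ici)
    (fun x hx => hW x hx.1) (fun x hx => hρM x hx.1)
  have hneg : (-S).OrdConnected := by
    refine ⟨fun x hx y hy z hz => ?_⟩
    exact hSc.out hy hx ⟨neg_le_neg hz.2, neg_le_neg hz.1⟩
  obtain ⟨C₂, h₂⟩ := volume_thickening_expSpiral_half_le (W := fun x => W (-x))
    (ρ := fun x => ρ (-x)) (D := D) (b := -b) (q := q) (neg_ne_zero.2 hb) hp hp1 hη
    (fun x => by rw [hWdef, mul_neg, neg_mul]) (fun x => hρdef _)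
    (S := (-S) ∩ Set.Ici 0) Set.inter_subset_right (hneg.inter Set.ordConnected_Ici)
    (fun x hx => hW _ hx.1) (fun x hx => hρM _ hx.1)
  -- The constants are made nonnegative because `ENNReal.ofReal` is not additive across signs.
  refine ⟨max C₁ 0 + max C₂ 0, ?_⟩
  filter_upwards [h₁, h₂, Ioo_mem_nhdsGT (zero_lt_one' ℝ)] with ε h₁ h₂ hε
  have hlog : 0 ≤ ε * (1 - Real.log ε) :=
    mul_nonneg hε.1.le (by linarith [Real.log_nonpos hε.1.le hε.2.le])
  have hsplit : S = (S ∩ Set.Ici 0) ∪ (S ∩ Set.Iic 0) := by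
    rw [← Set.inter_union_distrib_left, Set.Ici_union_Iic, Set.inter_univ]
  rw [hsplit, Set.image_union, Metric.thickening_union, add_mul, ENNReal.ofReal_add
    (mul_nonneg (le_max_right _ _) hlog) (mul_nonneg (le_max_right _ _) hlog)]
  refine (measure_union_le _ _).trans (add_le_add (h₁.trans ?_) ?_)
  · exact ENNReal.ofReal_le_ofReal (mul_le_mul_of_nonneg_right (le_max_left _ _) hlog)
  · rw [polarCurve_image_inter_Iic, volume_thickening_image_linearIsometryEquiv]
    exact h₂.trans
      (ENNReal.ofReal_le_ofReal (mul_le_mul_of_nonneg_right (le_max_left _ _) hlog))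

/-! ### Linear lower bound for neighbourhoods of polar curves. -/

lemma exists_ne_polarCurve {ρ : ℝ → ℝ} {S : Set ℝ} (hSc : S.OrdConnected) (hSn : S.Nontrivial)
    (hρ : ∀ x ∈ S, 0 < ρ x) : ∃ x ∈ S, ∃ y ∈ S, polarCurve ρ x ≠ polarCurve ρ y := by
  obtain ⟨x, hx, y, hy, hxy⟩ := hSn.exists_lt
  -- Angles that differ by a positive amount of at most `1 < 2π` give different points when the
  -- radii are positive.
  set y' := min y (x + 1) with hy'
  have hxy' : x < y' := lt_min hxy (by linarith)
  have hy'S : y' ∈ S := hSc.out hx hy ⟨hxy'.le, min_le_left _ _⟩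
  refine ⟨x, hx, y', hy'S, fun h => ?_⟩
  have hn := congrArg norm h
  rw [norm_polarCurve, norm_polarCurve, abs_of_pos (hρ x hx), abs_of_pos (hρ y' hy'S)] at hn
  have hne : (ρ y' : ℂ) ≠ 0 := by exact_mod_cast (hρ y' hy'S).ne'
  rw [polarCurve, polarCurve, hn, mul_right_inj' hne, Complex.exp_eq_exp_iff_exists_int] at h
  obtain ⟨n, hn⟩ := h
  have h1 : x = y' + n * (2 * Real.pi) := by
    have := congrArg Complex.im hn
    simpa using this
  have h2 : y' ≤ x + 1 := min_le_right _ _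
  have h3 := Real.pi_gt_three
  have h4 : n < 0 := by
    by_contra! h0
    have : (0 : ℝ) ≤ n := by exact_mod_cast h0
    nlinarith
  have h5 : (n : ℝ) ≤ -1 := by exact_mod_cast Int.le_sub_one_of_lt h4
  nlinarith

lemma le_volume_thickening_polarCurve {ρ : ℝ → ℝ} {S : Set ℝ} (hSc : S.OrdConnected)
    (hSn : S.Nontrivial) (hρ : ∀ x ∈ S, 0 < ρ x) (hρc : ContinuousOn ρ S) :
    ∃ c : ℝ, 0 < c ∧ ∀ᶠ ε in 𝓝[>] (0 : ℝ),
      ENNReal.ofReal (c * ε) ≤ volume (Metric.thickening ε (polarCurve ρ '' S)) := by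
  obtain ⟨x, hx, y, hy, hxy⟩ := exists_ne_polarCurve hSc hSn hρ
  refine ⟨_, dist_pos.2 hxy, ?_⟩
  filter_upwards [self_mem_nhdsWithin] with ε hε
  refine le_volume_thickening_of_isPreconnected (hSc.isPreconnected.image _ ?_)
    (Set.mem_image_of_mem _ hy) (Set.mem_image_of_mem _ hx) hε
  unfold polarCurve
  have : ContinuousOn (fun t => (ρ t : ℂ)) S := Complex.continuous_ofReal.comp_continuousOn hρc
  exact this.mul (by fun_prop)

/-! ### Areas in polar coordinates -/

/-- The complex number with given (signed) modulus and argument. -/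
noncomputable def polarMap (p : ℝ × ℝ) : ℂ := (p.1 : ℂ) * Complex.exp (p.2 * Complex.I)

lemma volume_image_polarMap (E : Set (ℝ × ℝ)) :
    volume (polarMap '' E) = volume (polarCoord.symm '' E) := by
  have h : polarMap '' E = Complex.measurableEquivRealProd ⁻¹' (polarCoord.symm '' E) := by
    rw [← Complex.measurableEquivRealProd.image_symm, Set.image_image]
    refine Set.image_congr fun p _ => ?_
    apply Complex.ext
    · simp [polarMap, polarCoord_symm_apply, Complex.exp_ofReal_mul_I_re]
    · simp [polarMap, polarCoord_symm_apply, Complex.exp_ofReal_mul_I_im]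
  rw [h, Complex.volume_preserving_equiv_real_prod.measure_preimage_equiv]

/-- The integral counts overlaps with multiplicity, so injectivity is needed only for equality. -/
lemma volume_image_polarMap_le {E : Set (ℝ × ℝ)} (hE : MeasurableSet E) :
    volume (polarMap '' E) ≤ ∫⁻ p in E, ENNReal.ofReal |p.1| := by
  rw [volume_image_polarMap]
  have := addHaar_image_le_lintegral_abs_det_fderiv (volume : Measure (ℝ × ℝ)) hE
    (fun p _ => (hasFDerivAt_polarCoord_symm p).hasFDerivWithinAt)
  simpa only [det_fderivPolarCoordSymm] using this

lemma volume_image_polarMap_eq {E : Set (ℝ × ℝ)} (hE : MeasurableSet E)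
    (hinj : Set.InjOn polarMap E) :
    volume (polarMap '' E) = ∫⁻ p in E, ENNReal.ofReal |p.1| := by
  rw [volume_image_polarMap]
  have hinj' : Set.InjOn polarCoord.symm E := by
    intro p hp q hq h
    refine hinj hp hq ?_
    simp only [polarCoord_symm_apply, Prod.mk.injEq] at h
    apply Complex.ext
    · simpa [polarMap, Complex.exp_ofReal_mul_I_re] using h.1
    · simpa [polarMap, Complex.exp_ofReal_mul_I_im] using h.2
  have := lintegral_abs_det_fderiv_eq_addHaar_image (volume : Measure (ℝ × ℝ)) hE
    (fun p _ => (hasFDerivAt_polarCoord_symm p).hasFDerivWithinAt) hinj'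
  simpa only [det_fderivPolarCoordSymm] using this.symm

/-- The set of polar coordinates `(r, φ)` with `φ ∈ (u, v)` and `|r - ρ φ| < h φ`. -/
def polarTube (ρ h : ℝ → ℝ) (u v : ℝ) : Set (ℝ × ℝ) :=
  {p | p.2 ∈ Set.Ioo u v ∧ p.1 ∈ Set.Ioo (ρ p.2 - h p.2) (ρ p.2 + h p.2)}

lemma measurableSet_polarTube {ρ h : ℝ → ℝ} (hρ : Measurable ρ) (hh : Measurable h) (u v : ℝ) :
    MeasurableSet (polarTube ρ h u v) :=
  (measurable_snd measurableSet_Ioo).inter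
    ((measurableSet_lt ((hρ.sub hh).comp measurable_snd) measurable_fst).inter
      (measurableSet_lt measurable_fst ((hρ.add hh).comp measurable_snd)))

lemma lintegral_polarTube {ρ h : ℝ → ℝ} (hρ : Measurable ρ) (hh : Measurable h) (u v : ℝ) :
    ∫⁻ p in polarTube ρ h u v, ENNReal.ofReal |p.1| =
      ∫⁻ φ in Set.Ioo u v, ∫⁻ r in Set.Ioo (ρ φ - h φ) (ρ φ + h φ), ENNReal.ofReal |r| := by
  have hm := measurableSet_polarTube hρ hh u v
  rw [← lintegral_indicator hm, Measure.volume_eq_prod, lintegral_prod_symm _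
    ((by fun_prop : Measurable fun p : ℝ × ℝ => ENNReal.ofReal |p.1|).indicator hm).aemeasurable,
    ← lintegral_indicator measurableSet_Ioo]
  refine lintegral_congr fun φ => ?_
  by_cases hφ : φ ∈ Set.Ioo u v
  · rw [Set.indicator_of_mem hφ, ← lintegral_indicator measurableSet_Ioo]
    refine lintegral_congr fun r => ?_
    by_cases hr : r ∈ Set.Ioo (ρ φ - h φ) (ρ φ + h φ)
    · rw [Set.indicator_of_mem hr, Set.indicator_of_mem (show (r, φ) ∈ polarTube ρ h u v from ⟨hφ, hr⟩)]
    · rw [Set.indicator_of_notMem hr,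
        Set.indicator_of_notMem (fun h' : (r, φ) ∈ polarTube ρ h u v => hr h'.2)]
  · rw [Set.indicator_of_notMem hφ]
    simp only [Set.indicator_of_notMem (fun h' : (_, φ) ∈ polarTube ρ h u v => hφ h'.1),
      lintegral_zero]

lemma setLIntegral_ofReal_eq_sub {A F : ℝ → ℝ} {u v : ℝ} (huv : u ≤ v)
    (hA : ∀ x ∈ Set.Icc u v, HasDerivAt A (F x) x) (hF : ContinuousOn F (Set.Icc u v))
    (hF0 : ∀ x ∈ Set.Icc u v, 0 ≤ F x) :
    ∫⁻ x in Set.Ioo u v, ENNReal.ofReal (F x) = ENNReal.ofReal (A v - A u) := by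
  have hi : IntervalIntegrable F volume u v := by
    refine ContinuousOn.intervalIntegrable ?_
    rwa [Set.uIcc_of_le huv]
  rw [← intervalIntegral.integral_eq_sub_of_hasDerivAt (by rwa [Set.uIcc_of_le huv]) hi,
    intervalIntegral.integral_of_le huv, integral_Ioc_eq_integral_Ioo,
    ofReal_integral_eq_lintegral_ofReal]
  · exact (hF.integrableOn_Icc).mono_set Set.Ioo_subset_Icc_self
  · filter_upwards [ae_restrict_mem measurableSet_Ioo] with x hx
    exact hF0 x (Set.Ioo_subset_Icc_self hx)

/-- On the slice at angle `φ`, of length `2h`, `|r|` is at most `ρ + h`. An integrand `F` with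
explicit primitive `A` dominates the result, so the bound involves only boundary values. The sign of
`A v - A u` is recorded so that the bound can be added to others under `ENNReal.ofReal`. -/
lemma volume_image_polarTube_le {ρ h F A : ℝ → ℝ} {u v : ℝ} (hρ : Measurable ρ) (hh : Measurable h)
    (huv : u ≤ v) (hA : ∀ x ∈ Set.Icc u v, HasDerivAt A (F x) x)
    (hF : ContinuousOn F (Set.Icc u v))
    (hρ0 : ∀ x ∈ Set.Icc u v, 0 ≤ ρ x) (hh0 : ∀ x ∈ Set.Icc u v, 0 ≤ h x)
    (hle : ∀ x ∈ Set.Icc u v, 2 * h x * (ρ x + h x) ≤ F x) :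
    0 ≤ A v - A u ∧ volume (polarMap '' polarTube ρ h u v) ≤ ENNReal.ofReal (A v - A u) := by
  have hF0 : ∀ x ∈ Set.Icc u v, 0 ≤ F x := fun x hx =>
    (mul_nonneg (mul_nonneg zero_le_two (hh0 x hx)) (add_nonneg (hρ0 x hx) (hh0 x hx))).trans
      (hle x hx)
  refine ⟨sub_nonneg.2 (monotoneOn_of_deriv_nonneg (convex_Icc u v)
    (fun x hx => (hA x hx).continuousAt.continuousWithinAt)
    (fun x hx => (hA x (interior_subset hx)).differentiableAt.differentiableWithinAt)
    (fun x hx => (hA x (interior_subset hx)).deriv ▸ hF0 x (interior_subset hx))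
    (Set.left_mem_Icc.2 huv) (Set.right_mem_Icc.2 huv) huv), ?_⟩
  refine (volume_image_polarMap_le (measurableSet_polarTube hρ hh u v)).trans ?_
  rw [lintegral_polarTube hρ hh, ← setLIntegral_ofReal_eq_sub huv hA hF hF0]
  refine setLIntegral_mono' measurableSet_Ioo fun φ hφ => ?_
  have hφ' := Set.Ioo_subset_Icc_self hφ
  have h1 := hρ0 φ hφ'
  have h2 := hh0 φ hφ'
  calc ∫⁻ r in Set.Ioo (ρ φ - h φ) (ρ φ + h φ), ENNReal.ofReal |r|
      ≤ ∫⁻ _ in Set.Ioo (ρ φ - h φ) (ρ φ + h φ), ENNReal.ofReal (ρ φ + h φ) := by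
        refine setLIntegral_mono' measurableSet_Ioo fun r hr => ENNReal.ofReal_le_ofReal ?_
        rw [abs_le]
        constructor <;> linarith [hr.1, hr.2]
    _ = ENNReal.ofReal (2 * h φ * (ρ φ + h φ)) := by
        rw [setLIntegral_const, Real.volume_Ioo, ← ENNReal.ofReal_mul (by linarith)]
        congr 1
        ring
    _ ≤ _ := ENNReal.ofReal_le_ofReal (hle φ hφ')

lemma le_volume_image_polarTube {ρ h F A : ℝ → ℝ} {u v : ℝ} (hρ : Measurable ρ) (hh : Measurable h)
    (huv : u ≤ v) (hA : ∀ x ∈ Set.Icc u v, HasDerivAt A (F x) x)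
    (hF : ContinuousOn F (Set.Icc u v)) (hF0 : ∀ x ∈ Set.Icc u v, 0 ≤ F x)
    (hhρ : ∀ x ∈ Set.Icc u v, h x ≤ ρ x)
    (hle : ∀ x ∈ Set.Icc u v, F x ≤ 2 * h x * (ρ x - h x))
    (hinj : Set.InjOn polarMap (polarTube ρ h u v)) :
    ENNReal.ofReal (A v - A u) ≤ volume (polarMap '' polarTube ρ h u v) := by
  rw [volume_image_polarMap_eq (measurableSet_polarTube hρ hh u v) hinj,
    lintegral_polarTube hρ hh, ← setLIntegral_ofReal_eq_sub huv hA hF hF0]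
  refine setLIntegral_mono' measurableSet_Ioo fun φ hφ => ?_
  have hφ' := Set.Ioo_subset_Icc_self hφ
  have h1 := hhρ φ hφ'
  calc ENNReal.ofReal (F φ) ≤ ENNReal.ofReal (2 * h φ * (ρ φ - h φ)) :=
        ENNReal.ofReal_le_ofReal (hle φ hφ')
    _ = ∫⁻ _ in Set.Ioo (ρ φ - h φ) (ρ φ + h φ), ENNReal.ofReal (ρ φ - h φ) := by
        rw [setLIntegral_const, Real.volume_Ioo, ← ENNReal.ofReal_mul (by linarith)]
        congr 1
        ring
    _ ≤ _ := by
        refine setLIntegral_mono' measurableSet_Ioo fun r hr => ENNReal.ofReal_le_ofReal ?_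
        exact hr.1.le.trans (le_abs_self r)

/-! ### Coils of a spiral with decreasing radius -/

lemma polarCurve_eq_polarMap (ρ : ℝ → ℝ) (φ : ℝ) : polarCurve ρ φ = polarMap (ρ φ, φ) := rfl

lemma exp_mul_I_add_zsmul (φ : ℝ) (n : ℤ) :
    Complex.exp (((φ + n * (2 * Real.pi) : ℝ) : ℂ) * Complex.I) = Complex.exp (φ * Complex.I) := by
  rw [Complex.exp_eq_exp_iff_exists_int]
  exact ⟨n, by push_cast; ring⟩

lemma exists_angle_mem_Ioc (z : ℂ) (ψ : ℝ) :
    ∃ φ ∈ Set.Ioc (ψ - 2 * Real.pi) ψ, z = polarMap (‖z‖, φ) := by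
  obtain ⟨n, hn, -⟩ := existsUnique_add_zsmul_mem_Ioc Real.two_pi_pos (Complex.arg z)
    (ψ - 2 * Real.pi)
  refine ⟨Complex.arg z + n * (2 * Real.pi), ?_, ?_⟩
  · simpa using hn
  · rw [polarMap, exp_mul_I_add_zsmul, Complex.norm_mul_exp_arg_mul_I]

lemma norm_polarMap_sub_polarMap (r s φ : ℝ) : ‖polarMap (r, φ) - polarMap (s, φ)‖ = |r - s| := by
  rw [polarMap, polarMap, ← sub_mul, norm_mul, Complex.norm_exp_ofReal_mul_I, mul_one,
    ← Complex.ofReal_sub, Complex.norm_real, Real.norm_eq_abs]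

/-- Where consecutive coils are less than `2 ε` apart, the `ε`-neighbourhood fills a disk. -/
lemma ball_diff_subset_thickening {ρ : ℝ → ℝ} {Φ ε : ℝ} (hanti : AntitoneOn ρ (Set.Ioi Φ))
    (hcont : ContinuousOn ρ (Set.Ioi Φ)) (hlim : Tendsto ρ atTop (𝓝 0))
    (hgap : ∀ φ, Φ < φ → ρ φ - ρ (φ + 2 * Real.pi) < 2 * ε) :
    Metric.ball (0 : ℂ) (ρ (Φ + 2 * Real.pi)) \ {0} ⊆
      Metric.thickening ε (polarCurve ρ '' Set.Ioi Φ) := by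
  rintro z ⟨hz, hz0⟩
  have h2π := Real.two_pi_pos
  rw [mem_ball_zero_iff] at hz
  have hzpos : 0 < ‖z‖ := norm_pos_iff.2 hz0
  obtain ⟨T, hT1, hT2⟩ := ((hlim.eventually_lt_const hzpos).and
    (eventually_ge_atTop (Φ + 2 * Real.pi))).exists
  -- With `ρ ψ = |z|` and the angle `φ` of `z` taken in `(ψ - 2π, ψ]`, monotonicity gives `ρ (φ +
  -- 2π) ≤ |z| ≤ ρ φ`. The gap is below `2ε`, so one of the two coils is within `ε` of `z`.
  obtain ⟨ψ, hψ, hψz⟩ := intermediate_value_Icc' hT2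
    (hcont.mono fun x hx => lt_of_lt_of_le (by linarith) hx.1) ⟨hT1.le, hz.le⟩
  have hψ2 : Φ + 2 * Real.pi < ψ := by
    refine lt_of_le_of_ne hψ.1 fun h => ?_
    rw [h, hψz] at hz
    exact lt_irrefl _ hz
  obtain ⟨φ, hφ, hzφ⟩ := exists_angle_mem_Ioc z ψ
  have hφΦ : Φ < φ := by linarith [hφ.1]
  have h1 : ‖z‖ ≤ ρ φ := by
    rw [← hψz]
    exact hanti hφΦ (show Φ < ψ by linarith) hφ.2
  have h2 : ρ (φ + 2 * Real.pi) ≤ ‖z‖ := by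
    rw [← hψz]
    exact hanti (show Φ < ψ by linarith) (show Φ < φ + 2 * Real.pi by linarith) (by linarith [hφ.1])
  have h3 := hgap φ hφΦ
  rw [Metric.mem_thickening_iff]
  by_cases h4 : ρ φ - ‖z‖ < ε
  · refine ⟨_, ⟨φ, hφΦ, rfl⟩, ?_⟩
    rw [dist_eq_norm]
    have : z - polarCurve ρ φ = polarMap (‖z‖, φ) - polarMap (ρ φ, φ) := by
      rw [polarCurve_eq_polarMap, ← hzφ]
    rw [this, norm_polarMap_sub_polarMap, abs_sub_comm, abs_of_nonneg (by linarith)]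
    exact h4
  · refine ⟨_, ⟨φ + 2 * Real.pi, show Φ < φ + 2 * Real.pi by linarith, rfl⟩, ?_⟩
    have hper : polarCurve ρ (φ + 2 * Real.pi) = polarMap (ρ (φ + 2 * Real.pi), φ) := by
      have := exp_mul_I_add_zsmul φ 1
      rw [Int.cast_one, one_mul] at this
      rw [polarCurve, polarMap, this]
    have : z - polarCurve ρ (φ + 2 * Real.pi) =
        polarMap (‖z‖, φ) - polarMap (ρ (φ + 2 * Real.pi), φ) := by
      rw [hper, ← hzφ]
    rw [dist_eq_norm, this, norm_polarMap_sub_polarMap, abs_of_nonneg (by linarith)]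
    linarith

/-- Where consecutive coils are at least `2 ε` apart, the radial `ε`-tube does not overlap. -/
lemma injOn_polarMap_polarTube {ρ : ℝ → ℝ} {u v ε : ℝ} (hε : 0 < ε)
    (hanti : AntitoneOn ρ (Set.Ioi u)) (hpos : ∀ φ, u < φ → 0 < ρ φ)
    (hgap : ∀ φ ∈ Set.Ioo u v, 2 * ε ≤ ρ φ - ρ (φ + 2 * Real.pi)) :
    Set.InjOn polarMap (polarTube ρ (fun _ => ε) u v) := by
  have h2π := Real.two_pi_pos
  have hr : ∀ p ∈ polarTube ρ (fun _ => ε) u v, 0 < p.1 := by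
    rintro ⟨r, φ⟩ ⟨hφ, hr⟩
    have := hgap φ hφ
    have := hpos (φ + 2 * Real.pi) (by have := hφ.1; simp only at this; linarith)
    have := hr.1
    simp only at *
    linarith
  -- If `φ'` were at least one full turn after `φ`, then `ρ φ' ≤ ρ φ - 2ε` and the open radial
  -- intervals of half-width `ε` would be disjoint. Used in both directions, this forces `n = 0`.
  have key : ∀ r φ r' φ' (n : ℤ), (r, φ) ∈ polarTube ρ (fun _ => ε) u v →
      (r', φ') ∈ polarTube ρ (fun _ => ε) u v → r = r' → φ' = φ + n * (2 * Real.pi) → n ≤ 0 := by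
    rintro r φ r' φ' n ⟨hφ, hr⟩ ⟨hφ', hr'⟩ hrr hn
    by_contra! h0
    have h1 : (1 : ℝ) ≤ n := by exact_mod_cast h0
    simp only at hφ hr hφ' hr'
    have h2 : ρ φ' ≤ ρ (φ + 2 * Real.pi) :=
      hanti (show u < φ + 2 * Real.pi by linarith [hφ.1]) hφ'.1 (by nlinarith)
    have := hgap φ hφ
    linarith [hr.1, hr'.2]
  rintro ⟨r, φ⟩ hp ⟨r', φ'⟩ hp' h
  have hn := congrArg norm h
  simp only [polarMap, norm_mul, Complex.norm_exp_ofReal_mul_I, mul_one, Complex.norm_real,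
    Real.norm_eq_abs] at hn
  rw [abs_of_pos (hr _ hp), abs_of_pos (hr _ hp')] at hn
  have hne : (r' : ℂ) ≠ 0 := by exact_mod_cast (hr _ hp').ne'
  simp only at hn
  subst hn
  simp only [polarMap] at h
  rw [mul_right_inj' hne, Complex.exp_eq_exp_iff_exists_int] at h
  obtain ⟨n, hn⟩ := h
  have h1 : φ = φ' + n * (2 * Real.pi) := by
    have := congrArg Complex.im hn
    simpa using this
  have h2 := key _ _ _ _ n hp' hp rfl h1
  have h3 := key _ _ _ _ (-n) hp hp' rfl (by push_cast; linarith)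
  have h4 : n = 0 := by omega
  rw [h4] at h1
  simp only [Int.cast_zero, zero_mul, add_zero] at h1
  rw [h1]

lemma polarTube_subset_thickening {ρ : ℝ → ℝ} {S : Set ℝ} {u v ε : ℝ} (hS : Set.Ioo u v ⊆ S) :
    polarMap '' polarTube ρ (fun _ => ε) u v ⊆ Metric.thickening ε (polarCurve ρ '' S) := by
  rintro _ ⟨⟨r, φ⟩, ⟨hφ, hr⟩, rfl⟩
  refine Metric.mem_thickening_iff.2 ⟨_, ⟨φ, hS hφ, rfl⟩, ?_⟩
  rw [dist_eq_norm, polarCurve_eq_polarMap, norm_polarMap_sub_polarMap, abs_lt]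
  simp only at hr
  constructor <;> linarith [hr.1, hr.2]

/-- Lower bound by the tube around the outer coils plus the disk filled by the inner ones. -/
lemma le_volume_thickening_coils {ρ A : ℝ → ℝ} {S : Set ℝ} {u Φ ε : ℝ} (hε : 0 < ε)
    (hρm : Measurable ρ) (huΦ : u ≤ Φ - 2 * Real.pi) (hS : Set.Ioi u ⊆ S)
    (hanti : AntitoneOn ρ (Set.Ici u)) (hcont : ContinuousOn ρ (Set.Ici u))
    (hpos : ∀ φ, u ≤ φ → 0 < ρ φ) (hlim : Tendsto ρ atTop (𝓝 0))
    (hgap_outer : ∀ φ ∈ Set.Icc u (Φ - 2 * Real.pi), 2 * ε ≤ ρ φ - ρ (φ + 2 * Real.pi))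
    (hgap_inner : ∀ φ, Φ < φ → ρ φ - ρ (φ + 2 * Real.pi) < 2 * ε)
    (hA : ∀ φ ∈ Set.Icc u (Φ - 2 * Real.pi), HasDerivAt A (2 * ε * (ρ φ - ε)) φ) :
    ENNReal.ofReal (A (Φ - 2 * Real.pi) - A u) +
        ENNReal.ofReal (Real.pi * ρ (Φ + 2 * Real.pi) ^ 2) ≤
      volume (Metric.thickening ε (polarCurve ρ '' S)) := by
  have h2π := Real.two_pi_pos
  have hερ : ∀ φ ∈ Set.Icc u (Φ - 2 * Real.pi), ε ≤ ρ φ := fun φ hφ => by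
    have h1 := hgap_outer φ hφ
    have h2 := hpos (φ + 2 * Real.pi) (by linarith [hφ.1])
    linarith
  have htube := le_volume_image_polarTube (ρ := ρ) (h := fun _ => ε)
    (F := fun φ => 2 * ε * (ρ φ - ε)) hρm measurable_const huΦ hA
    (continuousOn_const.mul ((hcont.mono fun x hx => hx.1).sub continuousOn_const))
    (fun φ hφ => mul_nonneg (by linarith) (by linarith [hερ φ hφ])) hερ
    (fun φ _ => le_rfl)
    (injOn_polarMap_polarTube hε (hanti.mono Set.Ioi_subset_Ici_self) (fun φ hφ => hpos φ hφ.le)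
      fun φ hφ => hgap_outer φ (Set.Ioo_subset_Icc_self hφ))
  have hball : ENNReal.ofReal (Real.pi * ρ (Φ + 2 * Real.pi) ^ 2) =
      volume (Metric.ball (0 : ℂ) (ρ (Φ + 2 * Real.pi)) \ {0}) := by
    rw [measure_sdiff_null (measure_singleton 0),
      volume_ball_complex _ (hpos _ (by linarith)).le]
  -- A tube point has `r > ρ φ - ε ≥ ρ (φ + 2π) + ε`, which exceeds the radius `ρ (Φ + 2π)` of the
  -- disk.
  have hdisj : Disjoint (polarMap '' polarTube ρ (fun _ => ε) u (Φ - 2 * Real.pi))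
      (Metric.ball (0 : ℂ) (ρ (Φ + 2 * Real.pi)) \ {0}) := by
    rw [Set.disjoint_left]
    rintro _ ⟨⟨r, φ⟩, ⟨hφ, hr⟩, rfl⟩ ⟨hb, -⟩
    simp only at hφ hr
    rw [mem_ball_zero_iff, polarMap, norm_mul, Complex.norm_exp_ofReal_mul_I, mul_one,
      Complex.norm_real, Real.norm_eq_abs] at hb
    have h1 := hgap_outer φ (Set.Ioo_subset_Icc_self hφ)
    have h2 : ρ (Φ + 2 * Real.pi) ≤ ρ (φ + 2 * Real.pi) :=
      hanti (show u ≤ φ + 2 * Real.pi by linarith [hφ.1])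
        (show u ≤ Φ + 2 * Real.pi by linarith) (by linarith [hφ.2])
    have h3 := le_abs_self r
    simp only at hb
    linarith [hr.1]
  rw [hball]
  refine (add_le_add_left htube _).trans ?_
  rw [← measure_union hdisj (measurableSet_ball.diff (measurableSet_singleton 0))]
  refine measure_mono (Set.union_subset ?_ ?_)
  · exact polarTube_subset_thickening (Set.Ioo_subset_Ioi_self.trans hS)
  · have hsub : Set.Ioi Φ ⊆ Set.Ici u := fun x hx => by
      have : Φ < x := hx
      exact (by linarith : u ≤ x)
    refine (ball_diff_subset_thickening (hanti.mono hsub) (hcont.mono hsub) hlim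
      hgap_inner).trans (Metric.thickening_subset_of_subset _ ?_)
    refine Set.image_mono fun x hx => hS ?_
    have : Φ < x := hx
    exact (by linarith : u < x)

/-- A point near `r e^{iφ}` has an angle near `φ`. -/
lemma exists_angle_near {x : ℂ} {r φ ε : ℝ} (hr : 0 < r) (hε : ε ≤ r / 2)
    (hx : ‖x - polarMap (r, φ)‖ < ε) :
    ∃ θ, |θ - φ| ≤ Real.pi * ε / r ∧ x = polarMap (‖x‖, θ) := by
  set y := x * Complex.exp (-(φ * Complex.I)) with hy
  have hunit : ‖Complex.exp (-(φ * Complex.I))‖ = 1 := by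
    rw [← neg_mul, ← Complex.ofReal_neg, Complex.norm_exp_ofReal_mul_I]
  have hyr : ‖y - r‖ < ε := by
    have : y - r = (x - polarMap (r, φ)) * Complex.exp (-(φ * Complex.I)) := by
      rw [hy, sub_mul, polarMap, mul_assoc, ← Complex.exp_add, add_neg_cancel, Complex.exp_zero,
        mul_one]
    rw [this, norm_mul, hunit, mul_one]
    exact hx
  have hnorm : ‖y‖ = ‖x‖ := by rw [hy, norm_mul, hunit, mul_one]
  refine ⟨φ + Complex.arg y, ?_, ?_⟩
  · rw [add_sub_cancel_left]
    have hre := (Complex.abs_re_le_norm (y - r)).trans_lt hyr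
    have him := (Complex.abs_im_le_norm (y - r)).trans_lt hyr
    simp only [Complex.sub_re, Complex.ofReal_re, Complex.sub_im, Complex.ofReal_im,
      sub_zero] at hre him
    have hre' := (abs_lt.1 hre).1
    have hrey : r / 2 < y.re := by linarith
    have hny : r / 2 < ‖y‖ := hrey.trans_le (Complex.re_le_norm y)
    -- As `y` lies in the right half-plane, Jordan's inequality bounds its argument by `π/2` times
    -- `|sin|`; with `|y| > r/2` this produces `π ε / r`.
    have h1 : |Complex.arg y| ≤ Real.pi / 2 :=
      Complex.abs_arg_le_pi_div_two_iff.2 (by linarith)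
    have h2 := Real.mul_abs_le_abs_sin h1
    rw [Complex.sin_arg, abs_div, abs_of_pos (by linarith : 0 < ‖y‖)] at h2
    have h3 : |y.im| / ‖y‖ ≤ ε / (r / 2) := by
      have hε0 : 0 ≤ ε := (norm_nonneg _).trans hx.le
      gcongr
    have hπ := Real.pi_pos
    calc |Complex.arg y| = Real.pi / 2 * (2 / Real.pi * |Complex.arg y|) := by field_simp
      _ ≤ Real.pi / 2 * (ε / (r / 2)) := by gcongr; exact h2.trans h3
      _ = Real.pi * ε / r := by field_simp
  · have h1 := Complex.norm_mul_exp_arg_mul_I y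
    rw [hnorm] at h1
    have h2 : x = y * Complex.exp (φ * Complex.I) := by
      rw [hy, mul_assoc, ← Complex.exp_add, neg_add_cancel, Complex.exp_zero, mul_one]
    rw [polarMap]
    conv_lhs => rw [h2, ← h1]
    rw [mul_assoc, ← Complex.exp_add]
    push_cast
    ring_nf

/-! ### The spiral `r = (m φ + c)^(-1/m)` -/

lemma hasDerivAt_rpow_neg {p x : ℝ} (hx : 0 < x) :
    HasDerivAt (fun x : ℝ => x ^ (-p)) (-p * x ^ (-p - 1)) x :=
  Real.hasDerivAt_rpow_const (Or.inl hx.ne')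

lemma abs_rpow_neg_sub_le {p X Y Z : ℝ} (hp : 0 < p) (hZ : 0 < Z) (hX : Z ≤ X) (hY : Z ≤ Y) :
    |X ^ (-p) - Y ^ (-p)| ≤ p * Z ^ (-p - 1) * |X - Y| := by
  refine (convex_Ici Z).norm_image_sub_le_of_norm_hasDerivWithin_le
    (f := fun x : ℝ => x ^ (-p)) (fun x hx => (hasDerivAt_rpow_neg (hZ.trans_le hx)).hasDerivWithinAt)
    (fun x hx => ?_) hY hX
  have hx' : Z ≤ x := hx
  rw [Real.norm_eq_abs, abs_mul, abs_neg, abs_of_pos hp,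
    abs_of_pos (Real.rpow_pos_of_pos (hZ.trans_le hx') _)]
  exact mul_le_mul_of_nonneg_left (Real.rpow_le_rpow_of_nonpos hZ hx' (by linarith)) hp.le

lemma le_rpow_neg_sub {p X Y : ℝ} (hp : 0 < p) (hX : 0 < X) (hXY : X < Y) :
    p * Y ^ (-p - 1) * (Y - X) ≤ X ^ (-p) - Y ^ (-p) := by
  obtain ⟨ξ, hξ, h⟩ := exists_hasDerivAt_eq_slope (fun x : ℝ => x ^ (-p))
    (fun x => -p * x ^ (-p - 1)) hXY
    (fun x hx => (hasDerivAt_rpow_neg (hX.trans_le hx.1)).continuousAt.continuousWithinAt)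
    (fun x hx => hasDerivAt_rpow_neg (hX.trans hx.1))
  rw [eq_div_iff (by linarith)] at h
  have h1 : Y ^ (-p - 1) ≤ ξ ^ (-p - 1) :=
    Real.rpow_le_rpow_of_nonpos (hX.trans hξ.1) hξ.2.le (by linarith)
  have h2 : p * Y ^ (-p - 1) * (Y - X) ≤ p * ξ ^ (-p - 1) * (Y - X) := by
    gcongr
  linarith

/-- The polar equation `r = (m φ + c)^(-1/m)`. -/
noncomputable def powerRadius (m : ℕ) (c φ : ℝ) : ℝ := (m * φ + c) ^ (-(m : ℝ)⁻¹)

section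

variable {m : ℕ} {c : ℝ}

lemma measurable_powerRadius : Measurable (powerRadius m c) := by
  unfold powerRadius
  fun_prop

lemma powerRadius_pos {φ : ℝ} (h : 0 < m * φ + c) : 0 < powerRadius m c φ :=
  Real.rpow_pos_of_pos h _

lemma powerRadius_anti {φ ψ : ℝ} (h : 0 < m * φ + c) (hφψ : φ ≤ ψ) :
    powerRadius m c ψ ≤ powerRadius m c φ :=
  Real.rpow_le_rpow_of_nonpos h (by gcongr) (by simp)

lemma hasDerivAt_affine_rpow {φ : ℝ} (q : ℝ) (h : 0 < m * φ + c) :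
    HasDerivAt (fun φ : ℝ => (m * φ + c) ^ q) (m * q * (m * φ + c) ^ (q - 1)) φ := by
  have h1 : HasDerivAt (fun φ : ℝ => m * φ + c) (m * 1) φ :=
    ((hasDerivAt_id φ).const_mul _).add_const _
  exact (h1.rpow_const (Or.inl h.ne')).congr_deriv (by ring)

lemma continuousAt_powerRadius {φ : ℝ} (h : 0 < m * φ + c) : ContinuousAt (powerRadius m c) φ :=
  (hasDerivAt_affine_rpow _ h).continuousAt

lemma tendsto_powerRadius (hm : 2 ≤ m) : Tendsto (powerRadius m c) atTop (𝓝 0) := by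
  have hm0 : (0 : ℝ) < m := by exact_mod_cast (by omega : 0 < m)
  exact (tendsto_rpow_neg_atTop (inv_pos.2 hm0)).comp
    (tendsto_atTop_add_const_right _ _ (tendsto_id.const_mul_atTop hm0))

/-- The spiral has radius `R` at the angle where `m φ + c = (R^m)⁻¹`. This and the next two lemmas
evaluate the powers that occur there. -/
lemma inv_pow_rpow_neg_inv (hm : 2 ≤ m) {R : ℝ} (hR : 0 < R) :
    ((R ^ m)⁻¹) ^ (-(m : ℝ)⁻¹) = R := by
  rw [Real.inv_rpow (by positivity), Real.rpow_neg (by positivity), inv_inv,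
    Real.pow_rpow_inv_natCast hR.le (by omega)]

lemma inv_pow_rpow_neg_inv_sub_one (hm : 2 ≤ m) {R : ℝ} (hR : 0 < R) :
    ((R ^ m)⁻¹) ^ (-(m : ℝ)⁻¹ - 1) = R ^ (m + 1) := by
  rw [Real.rpow_sub_one (by positivity), inv_pow_rpow_neg_inv hm hR]
  field_simp
  ring

lemma inv_pow_rpow_one_sub_inv (hm : 2 ≤ m) {R : ℝ} (hR : 0 < R) :
    ((R ^ m)⁻¹) ^ (1 - (m : ℝ)⁻¹) = R / R ^ m := by
  rw [sub_eq_add_neg, add_comm, Real.rpow_add_one (by positivity), inv_pow_rpow_neg_inv hm hR]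
  rfl

/-- Primitive of `powerRadius`. -/
lemma hasDerivAt_primitive_powerRadius (hm : 2 ≤ m) {φ : ℝ} (h : 0 < m * φ + c) :
    HasDerivAt (fun φ : ℝ => (m * φ + c) ^ (1 - (m : ℝ)⁻¹) / (m - 1)) (powerRadius m c φ) φ := by
  have hm2 : (2 : ℝ) ≤ m := by exact_mod_cast hm
  have hm1 : (m : ℝ) - 1 ≠ 0 := by linarith
  refine ((hasDerivAt_affine_rpow _ h).div_const _).congr_deriv ?_
  have h2 : (1 - (m : ℝ)⁻¹ - 1) = -(m : ℝ)⁻¹ := by ring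
  rw [h2, powerRadius]
  field_simp

/-- Lower bound for the area of the neighbourhood of radius `π R^(m+1)`, divided by `R²`. -/
noncomputable def lowerArea (m : ℕ) (c u R : ℝ) : ℝ :=
  2 * Real.pi / (m - 1) * (1 - 2 * Real.pi * m * R ^ m) ^ (1 - (m : ℝ)⁻¹)
    - 2 * Real.pi ^ 2 * R ^ m * ((1 - c * R ^ m) / m - 2 * Real.pi * R ^ m)
    - 2 * Real.pi * R ^ (m - 1) * ((m * u + c) ^ (1 - (m : ℝ)⁻¹) / (m - 1))
    + 2 * Real.pi ^ 2 * (R ^ m) ^ 2 * u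
    + Real.pi * ((1 + 2 * Real.pi * m * R ^ m) ^ (-(m : ℝ)⁻¹)) ^ 2

/-- Upper bound for the area of the neighbourhood of radius `π R^(m+1)`, divided by `R²`. -/
noncomputable def upperArea (m : ℕ) (c u δ K L R : ℝ) : ℝ :=
  2 * Real.pi / (m - 1) * (1 + m * δ * R ^ m) ^ (1 - (m : ℝ)⁻¹)
    + 2 * Real.pi ^ 2 * L ^ 2 * R ^ m * ((1 - c * R ^ m) / m + δ * R ^ m)
    + 2 * Real.pi * R ^ (m - 1) * K * (m * u + c) ^ (-(m : ℝ)⁻¹)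
    - 2 * Real.pi ^ 2 * L ^ 2 * (R ^ m) ^ 2 * u
    + Real.pi * (1 + Real.pi * R ^ m) ^ 2

/-- At `R = 0` only the first and the last term survive: the outer tube gives `2π/(m - 1)`, the
inner disk `π`. The condition `m ≥ 2` makes `R^(m - 1)` vanish. -/
lemma tendsto_lowerArea (hm : 2 ≤ m) (u : ℝ) :
    Tendsto (lowerArea m c u) (𝓝 0) (𝓝 (Real.pi + 2 * Real.pi / (m - 1))) := by
  have h0 : (0 : ℝ) ^ m = 0 := zero_pow (by omega)
  have h1 : (0 : ℝ) ^ (m - 1) = 0 := zero_pow (by omega)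
  have hc : ContinuousAt (lowerArea m c u) 0 := by
    unfold lowerArea
    have e1 : ContinuousAt (fun R : ℝ => (1 - 2 * Real.pi * m * R ^ m) ^ (1 - (m : ℝ)⁻¹)) 0 :=
      ContinuousAt.rpow_const (by fun_prop) (Or.inl (by simp [h0]))
    have e2 : ContinuousAt (fun R : ℝ => (1 + 2 * Real.pi * m * R ^ m) ^ (-(m : ℝ)⁻¹)) 0 :=
      ContinuousAt.rpow_const (by fun_prop) (Or.inl (by simp [h0]))
    fun_prop
  have := hc.tendsto
  simp only [lowerArea, h0, h1] at this
  simpa [add_comm] using this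

lemma tendsto_upperArea (hm : 2 ≤ m) (u δ K L : ℝ) :
    Tendsto (upperArea m c u δ K L) (𝓝 0) (𝓝 (Real.pi + 2 * Real.pi / (m - 1))) := by
  have h0 : (0 : ℝ) ^ m = 0 := zero_pow (by omega)
  have h1 : (0 : ℝ) ^ (m - 1) = 0 := zero_pow (by omega)
  have hc : ContinuousAt (upperArea m c u δ K L) 0 := by
    unfold upperArea
    have e1 : ContinuousAt (fun R : ℝ => (1 + m * δ * R ^ m) ^ (1 - (m : ℝ)⁻¹)) 0 :=
      ContinuousAt.rpow_const (by fun_prop) (Or.inl (by simp [h0]))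
    fun_prop
  have := hc.tendsto
  simp only [upperArea, h0, h1] at this
  simpa [add_comm] using this

/-- For this `ε`, `R` is the critical radius and `Φ` its angle. By the mean value theorem the gap
between `φ` and `φ + 2π` is at least `2ε` when `φ + 2π ≤ Φ`, and less than `2ε` when `φ > Φ`; hence
the tube stops at `Φ - 2π`. The omitted turns are of lower order. -/
lemma lowerArea_le_volume (hm : 2 ≤ m) {u R : ℝ} {S : Set ℝ} (hS : Set.Ioi u ⊆ S)
    (hu : 0 < m * u + c) (hR : 0 < R) (hRu : m * u + c + 2 * Real.pi * m ≤ (R ^ m)⁻¹) :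
    ENNReal.ofReal (R ^ 2 * lowerArea m c u R) ≤
      volume (Metric.thickening (Real.pi * R ^ (m + 1)) (polarCurve (powerRadius m c) '' S)) := by
  have hm2 : (2 : ℝ) ≤ m := by exact_mod_cast hm
  have hm0 : (0 : ℝ) < m := by linarith
  have hp : 0 < (m : ℝ)⁻¹ := inv_pos.2 hm0
  have h2π := Real.two_pi_pos
  have hQ : 0 < R ^ m := by positivity
  have hpos : ∀ φ, u ≤ φ → 0 < m * φ + c := fun φ hφ => by nlinarith
  set ε := Real.pi * R ^ (m + 1) with hε
  have hε0 : 0 < ε := by positivity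
  set Φ := ((R ^ m)⁻¹ - c) / m with hΦ
  have hmΦ : m * Φ + c = (R ^ m)⁻¹ := by rw [hΦ]; field_simp; ring
  have huΦ : u ≤ Φ - 2 * Real.pi := by
    rw [le_sub_iff_add_le, hΦ, le_div_iff₀ hm0]
    linarith
  have key := le_volume_thickening_coils (ρ := powerRadius m c)
    (A := fun φ => 2 * ε * ((m * φ + c) ^ (1 - (m : ℝ)⁻¹) / (m - 1) - ε * φ)) (Φ := Φ) hε0
    measurable_powerRadius huΦ hS
    (fun x hx y _ hxy => powerRadius_anti (hpos x hx) hxy)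
    (fun x hx => (continuousAt_powerRadius (hpos x hx)).continuousWithinAt)
    (fun x hx => powerRadius_pos (hpos x hx)) (tendsto_powerRadius hm) ?_ ?_ ?_
  · refine le_trans ?_ (ENNReal.ofReal_add_le.trans key)
    have hX1 : 0 ≤ 1 - 2 * Real.pi * m * R ^ m := by
      have h1 : 2 * Real.pi * m ≤ (R ^ m)⁻¹ := by linarith
      have h2 := mul_le_mul_of_nonneg_right h1 hQ.le
      rw [inv_mul_cancel₀ hQ.ne'] at h2
      linarith
    have hX2 : 0 ≤ 1 + 2 * Real.pi * m * R ^ m := by positivity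
    have e1 : (m * (Φ - 2 * Real.pi) + c) ^ (1 - (m : ℝ)⁻¹) =
        R / R ^ m * (1 - 2 * Real.pi * m * R ^ m) ^ (1 - (m : ℝ)⁻¹) := by
      have : m * (Φ - 2 * Real.pi) + c = (R ^ m)⁻¹ * (1 - 2 * Real.pi * m * R ^ m) := by
        rw [mul_sub, sub_add_eq_add_sub, hmΦ]; field_simp
      rw [this, Real.mul_rpow (by positivity) hX1, inv_pow_rpow_one_sub_inv hm hR]
    have e2 : powerRadius m c (Φ + 2 * Real.pi) =
        R * (1 + 2 * Real.pi * m * R ^ m) ^ (-(m : ℝ)⁻¹) := by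
      have : m * (Φ + 2 * Real.pi) + c = (R ^ m)⁻¹ * (1 + 2 * Real.pi * m * R ^ m) := by
        rw [mul_add, add_right_comm, hmΦ]; field_simp
      rw [powerRadius, this, Real.mul_rpow (by positivity) hX2, inv_pow_rpow_neg_inv hm hR]
    have e3 : R ^ m = R * R ^ (m - 1) := by rw [← pow_succ']; congr 1; omega
    have hΦQ : Φ * R ^ m = (1 - c * R ^ m) / m := by rw [hΦ]; field_simp
    refine ENNReal.ofReal_le_ofReal (le_of_eq ?_)
    rw [e1, e2, lowerArea, hε, pow_succ, ← hΦQ]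
    have hm1 : (m : ℝ) - 1 ≠ 0 := by linarith
    have e4 : R ^ m * (R / R ^ m) = R := by field_simp
    generalize (1 - 2 * Real.pi * m * R ^ m) ^ (1 - (m : ℝ)⁻¹) = a
    generalize (1 + 2 * Real.pi * m * R ^ m) ^ (-(m : ℝ)⁻¹) = b
    generalize (m * u + c) ^ (1 - (m : ℝ)⁻¹) = d
    generalize R / R ^ m = w at e4 ⊢
    have e5 : R * R ^ m * d = R ^ 2 * R ^ (m - 1) * d := by rw [e3]; ring
    linear_combination (-2 * Real.pi * R * a / (m - 1)) * e4 + (2 * Real.pi / (m - 1)) * e5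
  · intro φ hφ
    have hX := hpos φ hφ.1
    have hXY : m * φ + c < m * (φ + 2 * Real.pi) + c := by nlinarith
    have hYU : m * (φ + 2 * Real.pi) + c ≤ (R ^ m)⁻¹ := by
      rw [← hmΦ]
      have := hφ.2
      gcongr
      linarith
    have h1 := le_rpow_neg_sub hp hX hXY
    have h2 : R ^ (m + 1) ≤ (m * (φ + 2 * Real.pi) + c) ^ (-(m : ℝ)⁻¹ - 1) := by
      rw [← inv_pow_rpow_neg_inv_sub_one hm hR]
      exact Real.rpow_le_rpow_of_nonpos (hX.trans hXY) hYU (by linarith)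
    refine le_trans ?_ h1
    calc 2 * ε = (m : ℝ)⁻¹ * R ^ (m + 1) * (m * (2 * Real.pi)) := by rw [hε]; field_simp
      _ ≤ (m : ℝ)⁻¹ * (m * (φ + 2 * Real.pi) + c) ^ (-(m : ℝ)⁻¹ - 1) * (m * (2 * Real.pi)) := by
          gcongr
      _ = _ := by ring
  · intro φ hφ
    have hUX : (R ^ m)⁻¹ < m * φ + c := by
      rw [← hmΦ]
      gcongr
    have hX : 0 < m * φ + c := lt_trans (by positivity) hUX
    have h1 := abs_rpow_neg_sub_le hp hX le_rfl
      (show m * φ + c ≤ m * (φ + 2 * Real.pi) + c by nlinarith)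
    have h2 : (m * φ + c) ^ (-(m : ℝ)⁻¹ - 1) < R ^ (m + 1) := by
      rw [← inv_pow_rpow_neg_inv_sub_one hm hR]
      exact Real.rpow_lt_rpow_of_neg (by positivity) hUX (by linarith)
    have h3 : |m * φ + c - (m * (φ + 2 * Real.pi) + c)| = m * (2 * Real.pi) := by
      rw [abs_sub_comm, abs_of_nonneg (by nlinarith)]
      ring
    rw [h3] at h1
    refine (le_abs_self _).trans_lt (h1.trans_lt ?_)
    calc (m : ℝ)⁻¹ * (m * φ + c) ^ (-(m : ℝ)⁻¹ - 1) * (m * (2 * Real.pi))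
        < (m : ℝ)⁻¹ * R ^ (m + 1) * (m * (2 * Real.pi)) := by gcongr
      _ = 2 * ε := by rw [hε]; field_simp
  · intro φ hφ
    have h1 := hasDerivAt_primitive_powerRadius hm (hpos φ hφ.1)
    have h2 : HasDerivAt (fun φ : ℝ => ε * φ) (ε * 1) φ := (hasDerivAt_id φ).const_mul ε
    exact ((h1.sub h2).const_mul (2 * ε)).congr_deriv (by ring)

/-- A point within `ε` of a coil of radius at least `R` has an angle `θ` near that of the coil, and
between the two angles the radius moves by only `O(ε / (mθ + c))`. So it lies in a slightly
thickened radial tube. The choice of `δ` keeps `mθ + c` at least half of `mφ + c`. Coils of radius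
at most `R` contribute to the disk. -/
lemma thickening_subset_union_tube (hm : 2 ≤ m) {φ₀ δ R : ℝ} {S : Set ℝ} (hS : S ⊆ Set.Ici φ₀)
    (hX : 0 < m * φ₀ + c) (hδ : m * δ = (m * φ₀ + c) / 2) (hR : 0 < R)
    (hR1 : Real.pi * R ^ m ≤ 1 / 2) (hR2 : Real.pi ^ 2 * R ^ m < δ) :
    Metric.thickening (Real.pi * R ^ (m + 1)) (polarCurve (powerRadius m c) '' S) ⊆
      polarMap '' polarTube (powerRadius m c)
        (fun θ => Real.pi * R ^ (m + 1) * (1 + 8 * Real.pi / (m * θ + c)))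
        (φ₀ - δ) (((R ^ m)⁻¹ - c) / m + δ) ∪
      Metric.ball 0 (R + Real.pi * R ^ (m + 1)) := by
  have hm2 : (2 : ℝ) ≤ m := by exact_mod_cast hm
  have hm0 : (0 : ℝ) < m := by linarith
  have hp : 0 < (m : ℝ)⁻¹ := inv_pos.2 hm0
  have hp1 : (m : ℝ)⁻¹ ≤ 1 := inv_le_one_of_one_le₀ (by linarith)
  have hπ := Real.pi_pos
  set ε := Real.pi * R ^ (m + 1) with hε
  have hε0 : 0 < ε := by positivity
  intro x hx
  rw [Metric.mem_thickening_iff] at hx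
  obtain ⟨_, ⟨φ, hφS, rfl⟩, hxφ⟩ := hx
  have hφ : φ₀ ≤ φ := hS hφS
  have hXφ0 : m * φ₀ + c ≤ m * φ + c := by gcongr
  have hXφ : 0 < m * φ + c := hX.trans_le hXφ0
  rw [dist_eq_norm] at hxφ
  have hrpos := powerRadius_pos hXφ
  rcases lt_or_ge (m * φ + c) (R ^ m)⁻¹ with hU | hU
  · left
    have hRr : R ≤ powerRadius m c φ := by
      conv_lhs => rw [← inv_pow_rpow_neg_inv hm hR]
      exact Real.rpow_le_rpow_of_nonpos hXφ hU.le (by linarith)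
    have hεR : ε = R * (Real.pi * R ^ m) := by rw [hε, pow_succ]; ring
    have hεr : ε ≤ powerRadius m c φ / 2 := by
      rw [hεR]
      nlinarith
    obtain ⟨θ, hθ, hxθ⟩ := exists_angle_near hrpos hεr hxφ
    have hθδ : |θ - φ| < δ := by
      refine hθ.trans_lt (lt_of_le_of_lt ?_ hR2)
      rw [div_le_iff₀ hrpos, hεR]
      have : 0 ≤ Real.pi ^ 2 * R ^ m := by positivity
      nlinarith
    obtain ⟨hθ1, hθ2⟩ := abs_lt.1 hθδ
    have hmθ1 : m * φ - m * δ < m * θ := by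
      rw [← mul_sub]; gcongr; linarith
    have hmθ2 : m * θ < m * φ + m * δ := by
      rw [← mul_add]; gcongr; linarith
    have hXθ1 : (m * φ + c) / 2 ≤ m * θ + c := by linarith
    have hXθ2 : m * θ + c ≤ 2 * (m * φ + c) := by linarith
    have hXθ : 0 < m * θ + c := by linarith
    -- The factor `8` is `4 · 2`: halving the base costs `2^(1 + 1/m) ≤ 4`, and `mθ + c ≤ 2 (mφ +
    -- c)`.
    have hdiff : |powerRadius m c φ - powerRadius m c θ| ≤
        ε * (8 * Real.pi / (m * θ + c)) := by
      have h1 := abs_rpow_neg_sub_le hp (half_pos hXφ)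
        (by linarith : (m * φ + c) / 2 ≤ m * φ + c) hXθ1
      have h2 : |m * φ + c - (m * θ + c)| = m * |θ - φ| := by
        rw [abs_sub_comm, ← abs_of_pos hm0, ← abs_mul, abs_of_pos hm0]; congr 1; ring
      have h3 : ((m * φ + c) / 2) ^ (-(m : ℝ)⁻¹ - 1) ≤ 4 * (powerRadius m c φ / (m * φ + c)) := by
        rw [powerRadius, ← Real.rpow_sub_one hXφ.ne', Real.div_rpow hXφ.le zero_le_two,
          div_eq_mul_inv, ← Real.rpow_neg zero_le_two, mul_comm]
        gcongr
        calc (2 : ℝ) ^ (-(-(m : ℝ)⁻¹ - 1)) ≤ 2 ^ (2 : ℝ) :=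
              Real.rpow_le_rpow_of_exponent_le one_le_two (by linarith)
          _ = 4 := by norm_num
      calc |powerRadius m c φ - powerRadius m c θ|
          ≤ (m : ℝ)⁻¹ * ((m * φ + c) / 2) ^ (-(m : ℝ)⁻¹ - 1) * (m * |θ - φ|) := by
            rw [← h2]; exact h1
        _ ≤ (m : ℝ)⁻¹ * (4 * (powerRadius m c φ / (m * φ + c))) *
            (m * (Real.pi * ε / powerRadius m c φ)) := by gcongr
        _ = ε * (8 * Real.pi / (2 * (m * φ + c))) := by
            field_simp
            ring
        _ ≤ ε * (8 * Real.pi / (m * θ + c)) := by gcongr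
    have hnx : |‖x‖ - powerRadius m c φ| < ε := by
      refine lt_of_le_of_lt ?_ hxφ
      have h1 := abs_norm_sub_norm_le x (polarCurve (powerRadius m c) φ)
      rwa [norm_polarCurve, abs_of_pos hrpos] at h1
    refine ⟨(‖x‖, θ), ⟨⟨by simp only; linarith, ?_⟩, ?_⟩, hxθ.symm⟩
    · simp only
      have : φ < ((R ^ m)⁻¹ - c) / m := by
        rw [lt_div_iff₀ hm0]; linarith
      linarith
    · have h1 := abs_lt.1 hnx
      have h2 := abs_le.1 hdiff
      simp only [mul_add, mul_one]
      constructor <;> linarith [h1.1, h1.2, h2.1, h2.2]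
  · right
    have hRr : powerRadius m c φ ≤ R := by
      conv_rhs => rw [← inv_pow_rpow_neg_inv hm hR]
      exact Real.rpow_le_rpow_of_nonpos (by positivity) hU (by linarith)
    rw [mem_ball_zero_iff]
    have h1 := norm_le_norm_add_norm_sub' x (polarCurve (powerRadius m c) φ)
    rw [norm_polarCurve, abs_of_pos hrpos] at h1
    linarith

/-- Expanding `2h(ρ + h)` gives the main term `2ερ`, a term `16π ε ρ/(mφ + c)` with bounded
primitive, and an `ε²` term bounded through `L`, the value of `h/ε` at the left end. The last two
contribute `O(R^(m+1))` and `O(R^(m+2))`, negligible against `R²`. -/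
lemma volume_le_upperArea (hm : 2 ≤ m) {φ₀ δ L R : ℝ} {S : Set ℝ} (hS : S ⊆ Set.Ici φ₀)
    (hX : 0 < m * φ₀ + c) (hδ : m * δ = (m * φ₀ + c) / 2) (hR : 0 < R)
    (hR1 : Real.pi * R ^ m ≤ 1 / 2) (hR2 : Real.pi ^ 2 * R ^ m < δ)
    (hR3 : m * φ₀ + c ≤ (R ^ m)⁻¹) (hL : L = 1 + 8 * Real.pi / (m * (φ₀ - δ) + c)) :
    volume (Metric.thickening (Real.pi * R ^ (m + 1)) (polarCurve (powerRadius m c) '' S)) ≤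
      ENNReal.ofReal (R ^ 2 * upperArea m c (φ₀ - δ) δ (8 * Real.pi) L R) := by
  have hm2 : (2 : ℝ) ≤ m := by exact_mod_cast hm
  have hm0 : (0 : ℝ) < m := by linarith
  have hπ := Real.pi_pos
  have hδ0 : 0 < δ := by
    by_contra! h
    nlinarith
  have hQ : 0 < R ^ m := by positivity
  set ε := Real.pi * R ^ (m + 1) with hε
  have hε0 : 0 < ε := by positivity
  set u := φ₀ - δ with hu
  have hXu : 0 < m * u + c := by
    rw [hu, mul_sub, hδ]; linarith
  set Φ := ((R ^ m)⁻¹ - c) / m with hΦ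
  have hmΦ : m * Φ + c = (R ^ m)⁻¹ := by rw [hΦ]; field_simp; ring
  have hΦ0 : φ₀ ≤ Φ := by rw [hΦ, le_div_iff₀ hm0]; linarith
  have huv : u ≤ Φ + δ := by linarith
  have hpos : ∀ φ ∈ Set.Icc u (Φ + δ), 0 < m * φ + c := fun φ hφ => by
    have := hφ.1
    nlinarith
  have htube := volume_image_polarTube_le (ρ := powerRadius m c)
    (h := fun θ => ε * (1 + 8 * Real.pi / (m * θ + c)))
    (A := fun φ => 2 * ε * ((m * φ + c) ^ (1 - (m : ℝ)⁻¹) / (m - 1)) -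
      2 * ε * (8 * Real.pi) * (m * φ + c) ^ (-(m : ℝ)⁻¹) + 2 * ε ^ 2 * L ^ 2 * φ)
    (F := fun φ => 2 * ε * powerRadius m c φ +
      2 * ε * (8 * Real.pi) * (m * φ + c) ^ (-(m : ℝ)⁻¹ - 1) + 2 * ε ^ 2 * L ^ 2)
    measurable_powerRadius (by fun_prop) huv ?_ ?_
    (fun φ hφ => (powerRadius_pos (hpos φ hφ)).le) ?_ ?_
  · refine (measure_mono (thickening_subset_union_tube hm hS hX hδ hR hR1 hR2)).trans
      ((measure_union_le _ _).trans ((add_le_add_left htube.2 _).trans ?_))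
    have hv : 0 ≤ 1 + m * δ * R ^ m := by positivity
    have hXv : m * (Φ + δ) + c = (R ^ m)⁻¹ * (1 + m * δ * R ^ m) := by
      rw [mul_add, add_right_comm, hmΦ]; field_simp
    have e1 : (m * (Φ + δ) + c) ^ (1 - (m : ℝ)⁻¹) =
        R / R ^ m * (1 + m * δ * R ^ m) ^ (1 - (m : ℝ)⁻¹) := by
      rw [hXv, Real.mul_rpow (by positivity) hv, inv_pow_rpow_one_sub_inv hm hR]
    have e3 : R ^ m = R * R ^ (m - 1) := by rw [← pow_succ']; congr 1; omega
    have hΦQ : Φ * R ^ m = (1 - c * R ^ m) / m := by rw [hΦ]; field_simp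
    rw [volume_ball_complex _ (by positivity), ← ENNReal.ofReal_add]
    · refine ENNReal.ofReal_le_ofReal ?_
      -- These two boundary values enter the area with a minus sign and are simply dropped.
      have h1 : 0 ≤ 2 * ε * (8 * Real.pi) * (m * (Φ + δ) + c) ^ (-(m : ℝ)⁻¹) := by
        have := Real.rpow_nonneg (hpos _ (Set.right_mem_Icc.2 huv)).le (-(m : ℝ)⁻¹)
        positivity
      have h2 : 0 ≤ 2 * ε * ((m * u + c) ^ (1 - (m : ℝ)⁻¹) / (m - 1)) := by
        have := Real.rpow_nonneg hXu.le (1 - (m : ℝ)⁻¹)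
        have hm1 : (0 : ℝ) < m - 1 := by linarith
        positivity
      suffices h : 2 * ε * ((m * (Φ + δ) + c) ^ (1 - (m : ℝ)⁻¹) / (m - 1)) +
          2 * ε ^ 2 * L ^ 2 * (Φ + δ) + 2 * ε * (8 * Real.pi) * (m * u + c) ^ (-(m : ℝ)⁻¹) -
          2 * ε ^ 2 * L ^ 2 * u + Real.pi * (R + ε) ^ 2 =
          R ^ 2 * upperArea m c u δ (8 * Real.pi) L R by linarith
      rw [e1, upperArea, hε, pow_succ, ← hΦQ]
      have hm1 : (m : ℝ) - 1 ≠ 0 := by linarith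
      have e4 : R ^ m * (R / R ^ m) = R := by field_simp
      generalize (1 + m * δ * R ^ m) ^ (1 - (m : ℝ)⁻¹) = a
      generalize (m * u + c) ^ (-(m : ℝ)⁻¹) = d
      generalize R / R ^ m = w at e4 ⊢
      have e5 : R * R ^ m * d = R ^ 2 * R ^ (m - 1) * d := by rw [e3]; ring
      linear_combination (2 * Real.pi * R * a / (m - 1)) * e4 + (16 * Real.pi ^ 2) * e5
    · exact htube.1
    · positivity
  · intro φ hφ
    have hφ0 := hpos φ hφ
    have h1 := hasDerivAt_primitive_powerRadius hm hφ0
    have h2 := hasDerivAt_affine_rpow (-(m : ℝ)⁻¹) hφ0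
    have h3 : HasDerivAt (fun φ : ℝ => 2 * ε ^ 2 * L ^ 2 * φ) (2 * ε ^ 2 * L ^ 2 * 1) φ :=
      (hasDerivAt_id φ).const_mul _
    refine (((h1.const_mul (2 * ε)).sub (h2.const_mul (2 * ε * (8 * Real.pi)))).add
      h3).congr_deriv ?_
    field_simp
    ring
  · intro φ hφ
    have hφ0 := hpos φ hφ
    exact (((continuousAt_powerRadius hφ0).const_mul _).add
      ((hasDerivAt_affine_rpow _ hφ0).continuousAt.const_mul _)).add
        continuousAt_const |>.continuousWithinAt
  · intro φ hφ
    have := hpos φ hφ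
    positivity
  · intro φ hφ
    have hφ0 := hpos φ hφ
    have h1 : 1 + 8 * Real.pi / (m * φ + c) ≤ L := by
      rw [hL]
      have := hφ.1
      gcongr
    have h2 : (m * φ + c) ^ (-(m : ℝ)⁻¹ - 1) = powerRadius m c φ / (m * φ + c) := by
      rw [powerRadius, Real.rpow_sub_one hφ0.ne']
    have h3 : (1 + 8 * Real.pi / (m * φ + c)) ^ 2 ≤ L ^ 2 := by gcongr
    rw [h2]
    calc 2 * (ε * (1 + 8 * Real.pi / (m * φ + c))) *
          (powerRadius m c φ + ε * (1 + 8 * Real.pi / (m * φ + c)))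
        = 2 * ε * powerRadius m c φ + 2 * ε * (8 * Real.pi) * (powerRadius m c φ / (m * φ + c)) +
          2 * ε ^ 2 * (1 + 8 * Real.pi / (m * φ + c)) ^ 2 := by ring
      _ ≤ _ := by gcongr

/-- The area of the `ε`-neighbourhood of the spiral `r = (m φ + c)^(-1/m)` is asymptotic to a
multiple of `ε ^ (2 / (m + 1))`. -/
lemma tendsto_volume_powerSpiral (hm : 2 ≤ m) {φ₀ e : ℝ} {S : Set ℝ} (hX : 0 < m * φ₀ + c)
    (hS₁ : Set.Ioi φ₀ ⊆ S) (hS₂ : S ⊆ Set.Ici φ₀) (he : e = 2 / (m + 1)) :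
    Tendsto (fun ε => volume (Metric.thickening ε (polarCurve (powerRadius m c) '' S)) /
      ENNReal.ofReal (ε ^ e)) (𝓝[>] 0)
      (𝓝 (ENNReal.ofReal ((Real.pi + 2 * Real.pi / (m - 1)) / Real.pi ^ e))) := by
  have hm2 : (2 : ℝ) ≤ m := by exact_mod_cast hm
  have hm0 : (0 : ℝ) < m := by linarith
  have hπ := Real.pi_pos
  set δ := (m * φ₀ + c) / 2 / m with hδdef
  have hδ : m * δ = (m * φ₀ + c) / 2 := by rw [hδdef]; field_simp
  have hδ0 : 0 < δ := by positivity
  set L := 1 + 8 * Real.pi / (m * (φ₀ - δ) + c) with hL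
  -- `Rad ε` is the critical radius, the solution of `π R^(m+1) = ε`. Then `ε^e = π^e R²`, so the
  -- quotient lies between `lowerArea / π^e` and `upperArea / π^e`, which have the same limit.
  set Rad : ℝ → ℝ := fun ε => (ε / Real.pi) ^ (((m + 1 : ℕ) : ℝ)⁻¹) with hRad
  have hRadpos : ∀ ε, 0 < ε → 0 < Rad ε := fun ε hε =>
    Real.rpow_pos_of_pos (div_pos hε hπ) _
  have hRadε : ∀ ε, 0 < ε → Real.pi * Rad ε ^ (m + 1) = ε := fun ε hε => by
    rw [hRad]
    simp only
    rw [Real.rpow_inv_natCast_pow (div_pos hε hπ).le (by omega)]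
    field_simp
  have hRade : ∀ ε, 0 < ε → ε ^ e = Real.pi ^ e * Rad ε ^ 2 := fun ε hε => by
    have h1 : Rad ε ^ 2 = (ε / Real.pi) ^ e := by
      rw [hRad]
      simp only
      rw [← Real.rpow_natCast, ← Real.rpow_mul (div_pos hε hπ).le, he]
      congr 1
      push_cast
      ring
    rw [h1, ← Real.mul_rpow hπ.le (div_pos hε hπ).le, mul_div_cancel₀ _ hπ.ne']
  have hRad0 : Tendsto Rad (𝓝[>] 0) (𝓝[>] 0) := by
    refine tendsto_nhdsWithin_iff.2 ⟨?_, eventually_nhdsWithin_of_forall fun ε hε => hRadpos ε hε⟩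
    have hex : (0 : ℝ) < ((m + 1 : ℕ) : ℝ)⁻¹ := by positivity
    have hc : ContinuousAt Rad 0 :=
      ContinuousAt.rpow_const (by fun_prop) (Or.inr hex.le)
    have h0 : Rad 0 = 0 := by
      rw [hRad]
      simp only [zero_div]
      exact Real.zero_rpow hex.ne'
    have := hc.tendsto
    rw [h0] at this
    exact this.mono_left nhdsWithin_le_nhds
  have hpow : Tendsto (fun R : ℝ => R ^ m) (𝓝[>] 0) (𝓝[>] 0) := by
    refine tendsto_nhdsWithin_iff.2 ⟨?_, eventually_nhdsWithin_of_forall fun R hR =>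
      pow_pos (Set.mem_Ioi.1 hR) m⟩
    have : Tendsto (fun R : ℝ => R ^ m) (𝓝 0) (𝓝 (0 ^ m)) := (continuous_pow m).tendsto 0
    rw [zero_pow (by omega)] at this
    exact this.mono_left nhdsWithin_le_nhds
  have hpow0 : Tendsto (fun R : ℝ => R ^ m) (𝓝[>] 0) (𝓝 0) := hpow.mono_right nhdsWithin_le_nhds
  have hinv : Tendsto (fun R : ℝ => (R ^ m)⁻¹) (𝓝[>] 0) atTop := tendsto_inv_nhdsGT_zero.comp hpow
  have hev : ∀ᶠ R : ℝ in 𝓝[>] 0, 0 < R ∧ Real.pi * R ^ m ≤ 1 / 2 ∧ Real.pi ^ 2 * R ^ m < δ ∧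
      m * φ₀ + c ≤ (R ^ m)⁻¹ ∧ m * φ₀ + c + 2 * Real.pi * m ≤ (R ^ m)⁻¹ := by
    have h1 : ∀ᶠ R : ℝ in 𝓝[>] 0, Real.pi * R ^ m < 1 / 2 :=
      (hpow0.const_mul Real.pi).eventually_lt_const (by simp)
    have h2 : ∀ᶠ R : ℝ in 𝓝[>] 0, Real.pi ^ 2 * R ^ m < δ :=
      (hpow0.const_mul (Real.pi ^ 2)).eventually_lt_const (by simpa using hδ0)
    filter_upwards [self_mem_nhdsWithin, h1, h2, hinv.eventually_ge_atTop (m * φ₀ + c),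
      hinv.eventually_ge_atTop (m * φ₀ + c + 2 * Real.pi * m)] with R h h1 h2 h3 h4
    exact ⟨h, h1.le, h2, h3, h4⟩
  have hdiv : ∀ (ε y : ℝ), 0 < ε →
      ENNReal.ofReal (y / Real.pi ^ e) =
        ENNReal.ofReal (Rad ε ^ 2 * y) / ENNReal.ofReal (ε ^ e) := by
    intro ε y hε
    have h1 := hRadpos ε hε
    have h2 : 0 < Real.pi ^ e := Real.rpow_pos_of_pos hπ e
    rw [← ENNReal.ofReal_div_of_pos (Real.rpow_pos_of_pos hε e), hRade ε hε]
    congr 1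
    field_simp
  have hlim : ∀ f : ℝ → ℝ, Tendsto f (𝓝 0) (𝓝 (Real.pi + 2 * Real.pi / (m - 1))) →
      Tendsto (fun ε => ENNReal.ofReal (f (Rad ε) / Real.pi ^ e)) (𝓝[>] 0)
        (𝓝 (ENNReal.ofReal ((Real.pi + 2 * Real.pi / (m - 1)) / Real.pi ^ e))) := fun f hf =>
    ENNReal.tendsto_ofReal
      ((hf.comp (hRad0.mono_right nhdsWithin_le_nhds)).div_const (Real.pi ^ e))
  refine tendsto_of_tendsto_of_tendsto_of_le_of_le' (hlim _ (tendsto_lowerArea (c := c) hm φ₀))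
    (hlim _ (tendsto_upperArea (c := c) hm (φ₀ - δ) δ (8 * Real.pi) L)) ?_ ?_
  · filter_upwards [hRad0.eventually hev, self_mem_nhdsWithin] with ε hR hε
    rw [hdiv ε _ hε]
    refine ENNReal.div_le_div_right ?_ _
    have := lowerArea_le_volume hm hS₁ hX hR.1 hR.2.2.2.2
    rwa [hRadε ε hε] at this
  · filter_upwards [hRad0.eventually hev, self_mem_nhdsWithin] with ε hR hε
    rw [hdiv ε _ hε]
    refine ENNReal.div_le_div_right ?_ _
    have := volume_le_upperArea hm hS₂ hX hδ hR.1 hR.2.1 hR.2.2.1 hR.2.2.2.1 hL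
    rwa [hRadε ε hε] at this

end

/-! ### Trajectories in the complex plane -/

/-- The isometric identification of the Euclidean plane with `ℂ`. -/
noncomputable def toComplex : Space 2 ≃ₗᵢ[ℝ] ℂ := Complex.orthonormalBasisOneI.repr.symm

lemma toComplex_re (p : Space 2) : (toComplex p).re = p 0 := by
  simp [toComplex, Complex.orthonormalBasisOneI_repr_symm_apply]

lemma toComplex_im (p : Space 2) : (toComplex p).im = p 1 := by
  simp [toComplex, Complex.orthonormalBasisOneI_repr_symm_apply]

lemma norm_toComplex_pow (p : Space 2) (k : ℕ) :
    (p 0 ^ 2 + p 1 ^ 2) ^ k = ‖toComplex p‖ ^ (2 * k) := by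
  rw [pow_mul, ← Complex.normSq_eq_norm_sq, Complex.normSq_apply, toComplex_re, toComplex_im]
  ring

/-- The factor `1` is the speed `μ` of the common complex form; for the polynomial field it is
`|z|^(2k)`. -/
lemma toComplex_hopfField (k : ℕ) (a : ℝ) (p : Space 2) :
    toComplex (hopfField k a p) =
      ((1 : ℝ) : ℂ) * (Complex.I + (((‖toComplex p‖ ^ (2 * k))⁻¹ + a : ℝ) : ℂ)) * toComplex p := by
  apply Complex.ext
  · rw [toComplex_re, hopfField, norm_toComplex_pow]
    generalize (‖toComplex p‖ ^ (2 * k))⁻¹ + a = g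
    simp [toComplex_re, toComplex_im]
    ring
  · rw [toComplex_im, hopfField, norm_toComplex_pow]
    generalize (‖toComplex p‖ ^ (2 * k))⁻¹ + a = g
    simp [toComplex_re, toComplex_im]
    ring

lemma toComplex_hopfPolyField (k : ℕ) (a : ℝ) {p : Space 2} (hp : toComplex p ≠ 0) :
    toComplex (hopfPolyField k a p) =
      ((‖toComplex p‖ ^ (2 * k) : ℝ) : ℂ) *
        (Complex.I + (((‖toComplex p‖ ^ (2 * k))⁻¹ + a : ℝ) : ℂ)) * toComplex p := by
  have hw : ‖toComplex p‖ ^ (2 * k) ≠ 0 := pow_ne_zero _ (norm_ne_zero_iff.2 hp)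
  have h : ((‖toComplex p‖ ^ (2 * k) : ℝ) : ℂ) *
        (Complex.I + (((‖toComplex p‖ ^ (2 * k))⁻¹ + a : ℝ) : ℂ)) =
      ((‖toComplex p‖ ^ (2 * k) : ℝ) : ℂ) * Complex.I +
        ((1 + a * ‖toComplex p‖ ^ (2 * k) : ℝ) : ℂ) := by
    rw [mul_add, ← Complex.ofReal_mul, mul_add, mul_inv_cancel₀ hw, mul_comm a]
  rw [h]
  apply Complex.ext
  · rw [toComplex_re, hopfPolyField, norm_toComplex_pow]
    generalize ‖toComplex p‖ ^ (2 * k) = w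
    simp [toComplex_re, toComplex_im]
    ring
  · rw [toComplex_im, hopfPolyField, norm_toComplex_pow]
    generalize ‖toComplex p‖ ^ (2 * k) = w
    simp [toComplex_re, toComplex_im]
    ring

lemma toComplex_invert (p : Space 2) :
    toComplex (invert p) = ((1 / ‖toComplex p‖) ^ 2 : ℝ) • toComplex p := by
  simp [invert, EuclideanGeometry.inversion_def]

/-- Every trajectory away from the origin is a curve `r = W(φ)^(1/2k)` with `W` explicit. -/
lemma exists_polar_form_of_isTrajectory {k : ℕ} (hk : 1 ≤ k) {a δ : ℝ} (hδ : 0 < δ)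
    {X : Space 2 → Space 2} (hX : X = hopfField k a ∨ X = hopfPolyField k a) {Γ : Set (Space 2)}
    (hΓ : IsTrajectory X Γ) (haway : ∀ x ∈ Γ, δ ≤ ‖x‖) :
    ∃ (S : Set ℝ) (W : ℝ → ℝ), S.OrdConnected ∧ S.Nontrivial ∧
      (∀ φ ∈ S, δ ^ (2 * k) ≤ W φ) ∧
      toComplex '' Γ = polarCurve (fun φ => W φ ^ ((2 * k : ℝ)⁻¹)) '' S ∧
      (a = 0 → ∃ c, ∀ φ, W φ = 2 * k * φ + c) ∧
      (a ≠ 0 → ∃ C, ∀ φ, W φ = (C * Real.exp (2 * k * a * φ) - 1) / a) := by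
  obtain ⟨γ, J, hJ, hJn, hγ, rfl⟩ := hΓ
  have hzδ : ∀ t ∈ J, δ ≤ ‖toComplex (γ t)‖ := fun t ht => by
    rw [LinearIsometryEquiv.norm_map]
    exact haway _ (Set.mem_image_of_mem _ ht)
  have hz0 : ∀ t ∈ J, toComplex (γ t) ≠ 0 := fun t ht =>
    norm_pos_iff.1 (hδ.trans_le (hzδ t ht))
  have hd : ∀ t ∈ J, HasDerivWithinAt (fun s => toComplex (γ s)) (toComplex (X (γ t))) J t :=
    fun t ht => (toComplex.toContinuousLinearEquiv.toContinuousLinearMap.hasFDerivAt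
      |>.comp_hasDerivWithinAt t (hγ t ht))
  rw [Set.image_image]
  rcases hX with rfl | rfl
  · exact exists_polar_form hk hδ hJ hJn (fun _ _ => one_pos) continuousOn_const hzδ
      fun t ht => toComplex_hopfField k a (γ t) ▸ hd t ht
  · refine exists_polar_form hk hδ hJ hJn (μ := fun t => ‖toComplex (γ t)‖ ^ (2 * k))
      (fun t ht => pow_pos (norm_pos_iff.2 (hz0 t ht)) _)
      (fun t ht => ((hd t ht).continuousWithinAt.norm.pow _)) hzδ
      fun t ht => toComplex_hopfPolyField k a (hz0 t ht) ▸ hd t ht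

lemma toComplex_image_invert {W : ℝ → ℝ} {S : Set ℝ} {q : ℝ} {Γ : Set (Space 2)}
    (hW : ∀ φ ∈ S, 0 < W φ)
    (h : toComplex '' Γ = polarCurve (fun φ => W φ ^ q) '' S) :
    toComplex '' (invert '' Γ) = polarCurve (fun φ => W φ ^ (-q)) '' S := by
  have h1 : toComplex '' (invert '' Γ) =
      (fun z : ℂ => ((1 / ‖z‖) ^ 2 : ℝ) • z) '' (toComplex '' Γ) := by
    rw [Set.image_image, Set.image_image]
    exact Set.image_congr fun p _ => toComplex_invert p
  rw [h1, h, Set.image_image]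
  refine Set.image_congr fun φ hφ => ?_
  have hq : 0 < W φ ^ q := Real.rpow_pos_of_pos (hW φ hφ) q
  rw [norm_polarCurve, abs_of_pos hq, polarCurve, polarCurve, Complex.real_smul, ← mul_assoc,
    ← Complex.ofReal_mul, Real.rpow_neg (hW φ hφ).le]
  congr 2
  field_simp

lemma isBounded_iff_toComplex_image {Γ : Set (Space 2)} :
    Bornology.IsBounded Γ ↔ ∃ M, ∀ z ∈ toComplex '' Γ, ‖z‖ ≤ M := by
  rw [isBounded_iff_forall_norm_le]
  simp

lemma volume_thickening_toComplex (A : Set (Space 2)) (ε : ℝ) :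
    volume (Metric.thickening ε A) = volume (Metric.thickening ε (toComplex '' A)) :=
  (volume_thickening_image_linearIsometryEquiv toComplex A ε).symm

/-! ### Dimension of trajectories in the affine and the exponential case. -/

lemma hasBoxDim_and_measurable_of_affine {k : ℕ} (hk : 1 ≤ k) {δ c : ℝ} (hδ : 0 < δ)
    {Γ : Set (Space 2)} {S : Set ℝ} {W : ℝ → ℝ} (hS : S.OrdConnected) (hSn : S.Nontrivial)
    (hWδ : ∀ φ ∈ S, δ ^ (2 * k) ≤ W φ)
    (hΓ : toComplex '' Γ = polarCurve (fun φ => W φ ^ ((2 * k : ℝ)⁻¹)) '' S)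
    (hW : ∀ φ, W φ = 2 * k * φ + c) (hunb : ¬ Bornology.IsBounded Γ) :
    HasBoxDim Γ (4 * (k : ℝ) / (2 * (k : ℝ) + 1)) ∧ IsMinkowskiMeasurable Γ := by
  have hk1 : (1 : ℝ) ≤ k := by exact_mod_cast hk
  have hk0 : (0 : ℝ) < 2 * k := by linarith
  have hη : 0 < δ ^ (2 * k) := by positivity
  have hWpos : ∀ φ ∈ S, 0 < W φ := fun φ hφ => hη.trans_le (hWδ φ hφ)
  have hlow : ∀ φ ∈ S, (δ ^ (2 * k) - c) / (2 * k) ≤ φ := fun φ hφ => by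
    rw [div_le_iff₀ hk0]
    have := hWδ φ hφ
    rw [hW] at this
    linarith
  have hbdd : BddBelow S := ⟨_, hlow⟩
  -- Positivity of `W` bounds the angles below, and unboundedness of `Γ` makes them unbounded above.
  -- So `S` is a half-line, with or without its end point `φ₀`.
  have hfar : ∀ T, ∃ φ ∈ S, T < φ := by
    intro T
    by_contra! hT
    refine hunb (isBounded_iff_toComplex_image.2 ⟨(2 * k * T + c) ^ ((2 * k : ℝ)⁻¹), ?_⟩)
    rw [hΓ]
    rintro _ ⟨φ, hφ, rfl⟩
    have h1 := hWpos φ hφ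
    rw [norm_polarCurve, abs_of_pos (Real.rpow_pos_of_pos h1 _)]
    refine Real.rpow_le_rpow h1.le ?_ (inv_pos.2 hk0).le
    rw [hW]
    have := hT φ hφ
    gcongr
  set φ₀ := sInf S with hφ₀
  have hS₁ : Set.Ioi φ₀ ⊆ S := fun x hx => by
    obtain ⟨y, hy, hyx⟩ := (csInf_lt_iff hbdd hSn.nonempty).1 hx
    obtain ⟨w, hw, hxw⟩ := hfar x
    exact hS.out hy hw ⟨hyx.le, hxw.le⟩
  have hS₂ : S ⊆ Set.Ici φ₀ := fun x hx => csInf_le hbdd hx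
  -- The lower bound `δ^(2k)` passes to the infimum, so this holds even if `φ₀` is not in `S`.
  have hX₀ : 0 < ((2 * k : ℕ) : ℝ) * φ₀ + c := by
    have h1 := le_csInf hSn.nonempty hlow
    rw [div_le_iff₀ hk0] at h1
    push_cast
    linarith
  have hmodel : toComplex '' boundedModel Γ = polarCurve (powerRadius (2 * k) c) '' S := by
    have : boundedModel Γ = invert '' Γ := if_neg hunb
    rw [this, toComplex_image_invert hWpos hΓ]
    have h2 : (fun φ => W φ ^ (-(2 * k : ℝ)⁻¹)) = powerRadius (2 * k) c := by
      ext φ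
      rw [powerRadius, hW]
      push_cast
      rfl
    rw [h2]
  have hd : 0 < 4 * (k : ℝ) / (2 * (k : ℝ) + 1) := by positivity
  have hm1 : (0 : ℝ) < ((2 * k : ℕ) : ℝ) - 1 := by push_cast; linarith
  have hπ := Real.pi_pos
  have hlim := tendsto_volume_powerSpiral (m := 2 * k) (by omega) hX₀ hS₁ hS₂ rfl
  refine hasBoxDim_and_measurable_of_tendsto hd (M := ENNReal.ofReal
    ((Real.pi + 2 * Real.pi / (((2 * k : ℕ) : ℝ) - 1)) /
      Real.pi ^ (2 / (((2 * k : ℕ) : ℝ) + 1)))) ?_ ENNReal.ofReal_ne_top ?_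
  · have : 0 < Real.pi ^ (2 / (((2 * k : ℕ) : ℝ) + 1)) := Real.rpow_pos_of_pos hπ _
    exact (ENNReal.ofReal_pos.2 (by positivity)).ne'
  · refine hlim.congr fun ε => ?_
    rw [minkowskiQuotient, volume_thickening_toComplex, hmodel]
    congr 3
    push_cast
    field_simp
    ring

lemma hasBoxDim_one_of_exp {k : ℕ} (hk : 1 ≤ k) {a δ C : ℝ} (ha : a ≠ 0) (hδ : 0 < δ)
    {Γ : Set (Space 2)} {S : Set ℝ} {W : ℝ → ℝ} (hS : S.OrdConnected) (hSn : S.Nontrivial)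
    (hWδ : ∀ φ ∈ S, δ ^ (2 * k) ≤ W φ)
    (hΓ : toComplex '' Γ = polarCurve (fun φ => W φ ^ ((2 * k : ℝ)⁻¹)) '' S)
    (hW : ∀ φ, W φ = (C * Real.exp (2 * k * a * φ) - 1) / a) : HasBoxDim Γ 1 := by
  have hk1 : (1 : ℝ) ≤ k := by exact_mod_cast hk
  have hk0 : (0 : ℝ) < 2 * k := by linarith
  have hp0 : 0 < (2 * k : ℝ)⁻¹ := inv_pos.2 hk0
  have hp1 : (2 * k : ℝ)⁻¹ ≤ 1 := inv_le_one_of_one_le₀ (by linarith)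
  have hη : 0 < δ ^ (2 * k) := by positivity
  have hWpos : ∀ φ ∈ S, 0 < W φ := fun φ hφ => hη.trans_le (hWδ φ hφ)
  -- Bounded and inverted trajectories differ only in the sign of the exponent `p`. The radius is
  -- bounded by hypothesis in the first case and by the distance from the origin in the second.
  obtain ⟨p, M, hp, hp1, hM, hmodel⟩ : ∃ p M : ℝ, p ≠ 0 ∧ p ≤ 1 ∧ (∀ φ ∈ S, W φ ^ p ≤ M) ∧
      toComplex '' boundedModel Γ = polarCurve (fun φ => W φ ^ p) '' S := by
    by_cases hb : Bornology.IsBounded Γ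
    · obtain ⟨M, hM⟩ := isBounded_iff_toComplex_image.1 hb
      refine ⟨(2 * k : ℝ)⁻¹, M, hp0.ne', hp1, fun φ hφ => ?_, ?_⟩
      · have := hM _ (hΓ ▸ Set.mem_image_of_mem _ hφ)
        rwa [norm_polarCurve, abs_of_pos (Real.rpow_pos_of_pos (hWpos φ hφ) _)] at this
      · rw [show boundedModel Γ = Γ from if_pos hb, hΓ]
    · refine ⟨-(2 * k : ℝ)⁻¹, (δ ^ (2 * k)) ^ (-(2 * k : ℝ)⁻¹), by linarith, by linarith,
        fun φ hφ => Real.rpow_le_rpow_of_nonpos hη (hWδ φ hφ) (by linarith), ?_⟩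
      rw [show boundedModel Γ = invert '' Γ from if_neg hb, toComplex_image_invert hWpos hΓ]
  have hWc : Continuous W := by
    rw [funext hW]
    fun_prop
  obtain ⟨c₀, hc₀, hL⟩ := le_volume_thickening_polarCurve hS hSn
    (fun φ hφ => Real.rpow_pos_of_pos (hWpos φ hφ) p)
    (fun φ hφ => (hWc.continuousAt.rpow_const (Or.inl (hWpos φ hφ).ne')).continuousWithinAt)
  obtain ⟨C₀, hU⟩ := volume_thickening_expSpiral_le (W := W) (ρ := fun φ => W φ ^ p) (D := C / a)
    (b := 2 * k * a) (q := 1 / a) (mul_ne_zero hk0.ne' ha) hp hp1 hη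
    (fun φ => by rw [hW]; ring) (fun _ => rfl) hS hWδ hM
  refine hasBoxDim_one_of_bounds (c := c₀) (C := C₀) hc₀ ?_ ?_
  · simpa only [volume_thickening_toComplex, hmodel] using hL
  · simpa only [volume_thickening_toComplex, hmodel] using hU

end HopfInfinity

theorem theorem3p4 (k : ℕ) (hk : 1 ≤ k) (a : ℝ)
    (X : HopfInfinity.Space 2 → HopfInfinity.Space 2)
    (hX : X = HopfInfinity.hopfField k a ∨ X = HopfInfinity.hopfPolyField k a)
    (Γ : Set (HopfInfinity.Space 2)) (hΓ : HopfInfinity.IsTrajectory X Γ)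
    (haway : HopfInfinity.AwayFromOrigin Γ) :
    (a = 0 → ¬ Bornology.IsBounded Γ →
      HopfInfinity.HasBoxDim Γ (4 * (k : ℝ) / (2 * (k : ℝ) + 1)) ∧
        HopfInfinity.IsMinkowskiMeasurable Γ) ∧
    (a ≠ 0 → HopfInfinity.HasBoxDim Γ 1) := by
  obtain ⟨δ, hδ, haway⟩ := haway
  obtain ⟨S, W, hS, hSn, hWδ, hΓS, hW₀, hW₁⟩ :=
    HopfInfinity.exists_polar_form_of_isTrajectory hk hδ hX hΓ haway
  refine ⟨fun ha hunb => ?_, fun ha => ?_⟩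
  · obtain ⟨c, hW⟩ := hW₀ ha
    exact HopfInfinity.hasBoxDim_and_measurable_of_affine hk hδ hS hSn hWδ hΓS hW hunb
  · obtain ⟨C, hW⟩ := hW₁ ha
    exact HopfInfinity.hasBoxDim_one_of_exp hk ha hδ hS hSn hWδ hΓS hW
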